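/- **Setting.** Let $f:\mathbb R\times\mathbb R^d\to\mathbb R^d$ be $C^\infty$ and $2\pi$-periodic in its first variable, $T>0$, and $\langle u\rangle=\frac1{2\pi}\int_0^{2\pi}u(\tau)\,d\tau$. For $\varepsilon\in(0,1]$ let $y^\varepsilon$ solve $\dot y^\varepsilon(t)=f(t/\varepsilon,y^\varepsilon(t))$ on $[0,T]$, $y^\varepsilon(0)=y_0$. Put $\phi^{[0]}_\tau(y)=y$ and, for $k\ge 0$, $$F^{[k]}(y)=\Big(\tfrac{\partial\langle\phi^{[k]}_\cdot\rangle}{\partial y}(y)\Big)^{-1}\big\langle f(\cdot,\phi^{[k]}_\cdot(y))\big\rangle,\qquad \phi^{[k+1]}_\tau(y)=y+\varepsilon\int_0^\tau\Big(f(\sigma,\phi^{[k]}_\sigma(y))-\tfrac{\partial\phi^{[k]}_\sigma}{\partial y}(y)F^{[k]}(y)\Big)d\sigma .$$ Let $p,q\ge1$ be integers, $\Omega\subset\mathbb R^d$ compact, $h_+,\varepsilon_+>0$, and assume that the Jacobians $\partial_y\langle\phi^{[k]}\rangle(y)$ are invertible for $k\le p$, $y\in\Omega$, $\varepsilon\in[0,\varepsilon_+]$.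 Let $$g(\tau,w,v,\varepsilon)=f(\tau,\phi^{[p]}_\tau(v)+w)-\tfrac1\varepsilon\partial_\tau\phi^{[p]}_\tau(v)-\partial_y\phi^{[p]}_\tau(v)F^{[p]}(v).$$ **Numerical method.** Let $\Phi$ be a Runge–Kutta method (explicit or implicit, for non-autonomous systems) of order $p$, that is, with local error $O(h^{p+1})$ along every solution of every smooth finite-dimensional system. Let $F^{[p]}+\sum_{j\ge0}h^{p+j}a_j$ be the modified field of $F^{[p]}$ for $\Phi$: the coefficients $a_j(\varepsilon,y)$ are smooth near $[0,\varepsilon_+]\times\Omega$ and, for each $(\varepsilon,y)$ there, the method applied to the modified field reproduces the exact flow of $F^{[p]}$ as a formal power series in $h$. Let $\widetilde{F^{[p],[q]}_h}=F^{[p]}+\sum_{j=0}^{q-2}h^{p+j}a_j$ be its truncation, where the terms of order $h^{p+q-1}$ and higher are neglected. **Learned fields.** For $C^\infty$ maps $R$ and $R_F$ (for instance multilayer perceptrons with smooth activations) let $\phi_{\theta,+}(\tau,y,\varepsilon)=y+\varepsilon[R(\cos\tau,\sin\tau,y,\varepsilon)-R(1,0,y,\varepsilon)]$, $F_\theta(y,h,\varepsilon)=\langle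 f(\cdot,y)\rangle+R_F(y,h,\varepsilon)$ and $$g_\theta(\tau,w,v,\varepsilon)=f(\tau,\phi_{\theta,+}(\tau,v,\varepsilon)+w)-\tfrac1\varepsilon\partial_\tau\phi_{\theta,+}(\tau,v,\varepsilon)-\partial_y\phi_{\theta,+}(\tau,v,\varepsilon)F_\theta(v,0,\varepsilon).$$ The learning errors are $$\delta_{\phi,+}=\Big\|\tfrac{\phi^{[p]}-\phi_{\theta,+}}{\varepsilon}\Big\|,\qquad \delta_F=\big\|\widetilde{F^{[p],[q]}_h}-F_\theta\big\|_{L^\infty(\Omega\times[0,h_+]\times[0,\varepsilon_+])},\qquad \delta_g=\|g-g_\theta\|_{L^\infty([0,2\pi]\times\Omega\times\Omega\times(0,\varepsilon_+])},$$ where the first norm is the $W^{1,\infty}$-norm in $(\tau,y)\in[0,2\pi]\times\Omega$ (the maximum of the sup norms of the function and of its first derivatives in $\tau$ and in $y$) and the sup norm in $\varepsilon\in(0,\varepsilon_+]$; all $L^\infty$-norms are suprema. **Scheme.** Let $h=T/N\le h_+$ with an integer $N\ge1$, and $t_n=nh$. Starting from $(v_{\theta,0},w_{\theta,0})=(y_0,0)$,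 the iterates $(v_{\theta,n},w_{\theta,n})$ are computed with $\Phi$: $v$ is advanced with the field $F_\theta(\cdot,h,\varepsilon)$, so $v_{\theta,n}=(\Phi_h^{F_\theta(\cdot,h,\varepsilon)})^n(y_0)$, and $w$ with the time-dependent field $g_\theta(t/\varepsilon,\cdot,v,\varepsilon)$, whose source $v$ is taken at the stage values of the $v$-step (that is, $\Phi$ is applied to the coupled system). Put $y^\varepsilon_{\theta,n}=\phi_{\theta,+}(t_n/\varepsilon,v_{\theta,n},\varepsilon)+w_{\theta,n}$. **Theorem.** There are constants $\alpha_\phi,\lambda,\mu,\beta,M',\overline C,C>0$, independent of $h$, of $\varepsilon$, of $y_0$ and of the learned maps $R,R_F$, such that the following holds for all $C^\infty$ maps $R,R_F$, all $h=T/N\le h_+$ and all $\varepsilon\in(0,1]$ with $\varepsilon\le\varepsilon_+$. Let $v$ be a solution on $[0,T]$ of $\dot v=F^{[p]}(v)$, $v(0)=y_0$, and suppose that $v(t)$ and $w(t)=y^\varepsilon(t)-\phi^{[p]}_{t/\varepsilon}(v(t))$ for $t\in[0,T]$, as well as the numerical values $v_{\theta,n},w_{\theta,n}$ for $n\le N$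 and their stage values, lie in $\Omega$. Then $$\max_{0\le n\le N}|y^\varepsilon(t_n)-y^\varepsilon_{\theta,n}|\le\delta_{\phi,+}\,\varepsilon+\alpha_\phi\frac{e^{\lambda T}-1}{\lambda}\big[\overline C h^{p+q-1}+C\delta_F\big]+\frac{e^{\mu T}-1}{\mu}\Big[M'h^p+\frac{e^{\lambda T}-1}{\lambda}\,\beta\,\big(\overline C h^{p+q-1}+C\delta_F\big)+C\delta_g\Big].$$ -/

import Mathlib

open scoped ContDiff ENNReal

namespace MicroMacro

noncomputable section

section Averaging

variable {E : Type*} [NormedAddCommGroup E] [NormedSpace ℝ E]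

/-- The average `⟨u⟩` of a `2π`-periodic function `u` over one period. -/
def avg (u : ℝ → E) : E :=
  (2 * Real.pi)⁻¹ • ∫ τ in (0 : ℝ)..(2 * Real.pi), u τ

/-- The Jacobian at `y` of the averaged change of variables `x ↦ ⟨φ_·(x)⟩`. -/
def avgJacobian (φ : ℝ → E → E) (y : E) : E →L[ℝ] E :=
  fderiv ℝ (fun x => avg (fun τ => φ τ x)) y

/-- The averaged field attached to a change of variables `φ`:
`y ↦ (∂_y ⟨φ⟩(y))⁻¹ ⟨f(·, φ_·(y))⟩`. -/
def fieldOf (f φ : ℝ → E → E) (y : E) : E :=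
  (avgJacobian φ y).inverse (avg (fun τ => f τ (φ τ y)))

/-- The high oscillation generator `φ^{[k]}_τ(y)` for the parameter `ε`:
`φ^{[0]}_τ(y) = y` and
`φ^{[k+1]}_τ(y) = y + ε ∫_0^τ (f(σ, φ^{[k]}_σ(y)) - ∂_y φ^{[k]}_σ(y) F^{[k]}(y)) dσ`. -/
def phi (f : ℝ → E → E) (ε : ℝ) : ℕ → ℝ → E → E
  | 0 => fun _ y => y
  | k + 1 => fun τ y =>
      y + ε • ∫ σ in (0 : ℝ)..τ,
        (f σ (phi f ε k σ y) - fderiv ℝ (phi f ε k σ) y (fieldOf f (phi f ε k) y))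

/-- The averaged field `F^{[k]}(y) = (∂_y ⟨φ^{[k]}⟩(y))⁻¹ ⟨f(·, φ^{[k]}_·(y))⟩`; in particular
`F^{[0]} = ⟨f⟩`. -/
def field (f : ℝ → E → E) (ε : ℝ) (k : ℕ) : E → E :=
  fieldOf f (phi f ε k)

/-- The vector field of the micro part for a change of variables `φ` and an averaged field `F`:
`g(τ, w, v) = f(τ, φ_τ(v) + w) - ε⁻¹ ∂_τ φ_τ(v) - ∂_y φ_τ(v) F(v)`. -/
def micro (f φ : ℝ → E → E) (F : E → E) (ε τ : ℝ) (w v : E) : E :=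
  f τ (φ τ v + w) - ε⁻¹ • deriv (fun σ => φ σ v) τ - fderiv ℝ (φ τ) v (F v)

/-- The exact micro field `g`, built from `φ^{[p]}` and `F^{[p]}`. -/
def g (f : ℝ → E → E) (p : ℕ) (τ : ℝ) (w v : E) (ε : ℝ) : E :=
  micro f (phi f ε p) (field f ε p) ε τ w v

/-! Learned quantities, built from the networks `R` and `RF`. -/

/-- `φ_{θ,+}(τ, y, ε) = y + ε (R(cos τ, sin τ, y, ε) - R(1, 0, y, ε))`. -/
def phiNet (R : ℝ → ℝ → E → ℝ → E) (τ : ℝ) (y : E) (ε : ℝ) : E :=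
  y + ε • (R (Real.cos τ) (Real.sin τ) y ε - R 1 0 y ε)

/-- `F_θ(y, h, ε) = ⟨f⟩(y) + RF(y, h, ε)`. -/
def fieldNet (f : ℝ → E → E) (RF : E → ℝ → ℝ → E) (y : E) (h ε : ℝ) : E :=
  avg (fun τ => f τ y) + RF y h ε

/-- The learned micro field `g_θ(τ, w, v, ε)`, built from `φ_{θ,+}` and `F_θ(·, 0, ε)`. -/
def gNet (f : ℝ → E → E) (R : ℝ → ℝ → E → ℝ → E) (RF : E → ℝ → ℝ → E)
    (τ : ℝ) (w v : E) (ε : ℝ) : E :=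
  micro f (fun σ x => phiNet R σ x ε) (fun x => fieldNet f RF x 0 ε) ε τ w v

end Averaging

section RungeKutta

/-- A Runge-Kutta method (explicit or implicit) with `s` stages, for non-autonomous systems. -/
structure ButcherTableau (s : ℕ) where
  A : Fin s → Fin s → ℝ
  b : Fin s → ℝ
  c : Fin s → ℝ

variable {V : Type*} [NormedAddCommGroup V] [NormedSpace ℝ V] {s : ℕ}

/-- `Y` are stage values of the step of size `h` from `y` at time `t` for `ż = G(t, z)`. -/
def IsStages (tab : ButcherTableau s) (G : ℝ → V → V) (t h : ℝ) (y : V) (Y : Fin s → V) : Prop :=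
  ∀ i, Y i = y + h • ∑ j, tab.A i j • G (t + tab.c j * h) (Y j)

/-- The result of the step of size `h` from `y` at time `t` with stage values `Y`. -/
def stepValue (tab : ButcherTableau s) (G : ℝ → V → V) (t h : ℝ) (y : V) (Y : Fin s → V) : V :=
  y + h • ∑ j, tab.b j • G (t + tab.c j * h) (Y j)

/-- `z` solves `ż = G(t, z)` on `[t₀, t₁]`. -/
def IsSolutionOn (G : ℝ → V → V) (t₀ t₁ : ℝ) (z : ℝ → V) : Prop :=
  ∀ t ∈ Set.Icc t₀ t₁, HasDerivWithinAt z (G t (z t)) (Set.Icc t₀ t₁) t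

/-- One step with the (possibly step size dependent) field `G h`, started at time `t` from `z t`,
agrees with the curve `z` at time `t + h` up to `O(h ^ m)` as `h → 0⁺`. For an implicit method, the
stage values are those close to `z t`, which exist and are unique for small `h`. -/
def LocalErrorO (tab : ButcherTableau s) (G : ℝ → ℝ → V → V) (t : ℝ) (z : ℝ → V) (m : ℕ) : Prop :=
  ∃ K : ℝ, ∃ h₀ > (0 : ℝ), ∃ ρ > (0 : ℝ), ∀ h ∈ Set.Ioc 0 h₀, ∀ Y : Fin s → V,
    IsStages tab (G h) t h (z t) Y → (∀ i, ‖Y i - z t‖ ≤ ρ) →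
      ‖z (t + h) - stepValue tab (G h) t h (z t) Y‖ ≤ K * h ^ m

/-- The method has order (at least) `p`: for every smooth finite-dimensional system, its local error
along every exact solution is `O(h ^ (p + 1))`. -/
def HasOrder (tab : ButcherTableau s) (p : ℕ) : Prop :=
  ∀ (V : Type) [NormedAddCommGroup V] [NormedSpace ℝ V] [FiniteDimensional ℝ V]
    (G : ℝ → V → V) (U : Set (ℝ × V)), IsOpen U →
    ContDiffOn ℝ ∞ (fun x : ℝ × V => G x.1 x.2) U →
    ∀ (t r : ℝ) (z : ℝ → V), 0 < r → (t, z t) ∈ U → IsSolutionOn G t (t + r) z →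
      LocalErrorO tab (fun _ => G) t z (p + 1)

/-- The truncation `F + ∑_{j < q - 1} h ^ (p + j) a_j` of the formal field `F + ∑_j h ^ (p + j) a_j`,
in which the terms of order `h ^ (p + q - 1)` and higher are neglected. -/
def truncModified (p q : ℕ) (F : V → V) (a : ℕ → V → V) (h : ℝ) (y : V) : V :=
  F y + ∑ j ∈ Finset.range (q - 1), h ^ (p + j) • a j y

/-- `a 0, a 1, …` are the coefficients, near the set `K` of parameters and states, of the modified
field `F(ε, ·) + ∑_j h ^ (p + j) a_j(ε, ·)` of the family `F(ε, ·)` for the given method: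
they are smooth in `(ε, y)`, and the method applied to the modified field reproduces the exact flow
of `F(ε, ·)` in the sense of formal power series in `h`. This determines the coefficients near `K`
for a smooth family `F` and a method of order `p ≥ 1`. -/
def IsModifiedField (tab : ButcherTableau s) (p : ℕ) (F : ℝ → V → V) (a : ℕ → ℝ → V → V)
    (K : Set (ℝ × V)) : Prop :=
  ∃ U : Set (ℝ × V), IsOpen U ∧ K ⊆ U ∧
    (∀ j, ContDiffOn ℝ ∞ (fun x : ℝ × V => a j x.1 x.2) U) ∧
    ∀ (ε r : ℝ) (z : ℝ → V), 0 < r → (ε, z 0) ∈ U → IsSolutionOn (fun _ => F ε) 0 r z →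
      ∀ q : ℕ, 1 ≤ q →
        LocalErrorO tab (fun h _ => truncModified p q (F ε) (fun j => a j ε) h) 0 z (p + q)

end RungeKutta

section Scheme

variable {E : Type*} [NormedAddCommGroup E] [NormedSpace ℝ E] {s : ℕ}

/-- The learned macro-micro vector field `(v, w) ↦ (F_θ(v, h, ε), g_θ(t / ε, w, v, ε))`. -/
def learnedField (f : ℝ → E → E) (R : ℝ → ℝ → E → ℝ → E) (RF : E → ℝ → ℝ → E)
    (h ε t : ℝ) (x : E × E) : E × E :=
  (fieldNet f RF x.1 h ε, gNet f R RF (t / ε) x.2 x.1 ε)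

/-- `(v n, w n)`, `0 ≤ n ≤ N`, is computed by the micro-macro corrected learned scheme with step size
`h` from `(y₀, 0)`; the iterates and the stage values lie in `Ω`, where the fields are learned. -/
structure IsScheme (tab : ButcherTableau s) (f : ℝ → E → E) (R : ℝ → ℝ → E → ℝ → E)
    (RF : E → ℝ → ℝ → E) (Ω : Set E) (h ε : ℝ) (N : ℕ) (y₀ : E) (v w : ℕ → E) : Prop where
  init_v : v 0 = y₀
  init_w : w 0 = 0
  mem : ∀ n ≤ N, v n ∈ Ω ∧ w n ∈ Ω
  step : ∀ n < N, ∃ Y : Fin s → E × E, (∀ i, Y i ∈ Ω ×ˢ Ω) ∧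
    IsStages tab (learnedField f R RF h ε) (n * h) h (v n, w n) Y ∧
    (v (n + 1), w (n + 1)) = stepValue tab (learnedField f R RF h ε) (n * h) h (v n, w n) Y

end Scheme

section LearningErrors

variable {E : Type*} [NormedAddCommGroup E] [NormedSpace ℝ E]

/-- The supremum norm of `u` on the set `S`. -/
def supNorm {X : Type*} (S : Set X) (u : X → ℝ≥0∞) : ℝ≥0∞ := ⨆ x ∈ S, u x

/-- The quotient `(φ^{[p]} - φ_{θ,+}) / ε`. -/
def phiError (f : ℝ → E → E) (p : ℕ) (R : ℝ → ℝ → E → ℝ → E) (ε τ : ℝ) (y : E) : E :=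
  ε⁻¹ • (phi f ε p τ y - phiNet R τ y ε)

/-- `δ_{φ,+}`: the `W^{1,∞}`-norm in `(τ, y)` (the maximum of the supremum norms of the function and
of its first derivatives), and supremum norm in `ε`, of `(φ^{[p]} - φ_{θ,+}) / ε`. -/
def deltaPhi (f : ℝ → E → E) (p : ℕ) (R : ℝ → ℝ → E → ℝ → E) (Ω : Set E) (εmax : ℝ) : ℝ≥0∞ :=
  supNorm (Set.Ioc 0 εmax ×ˢ Set.Icc 0 (2 * Real.pi) ×ˢ Ω) fun x : ℝ × ℝ × E =>
    max ‖phiError f p R x.1 x.2.1 x.2.2‖ₑ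
      (max ‖deriv (fun τ => phiError f p R x.1 τ x.2.2) x.2.1‖ₑ
        ‖fderiv ℝ (fun y => phiError f p R x.1 x.2.1 y) x.2.2‖ₑ)

/-- `δ_F`: the supremum norm of the difference between the truncated modified field of `F^{[p]}` and
`F_θ`, over `y ∈ Ω`, `h ∈ [0, hmax]`, `ε ∈ [0, εmax]`. -/
def deltaF (f : ℝ → E → E) (p q : ℕ) (a : ℕ → ℝ → E → E) (RF : E → ℝ → ℝ → E)
    (Ω : Set E) (hmax εmax : ℝ) : ℝ≥0∞ :=
  supNorm (Ω ×ˢ Set.Icc 0 hmax ×ˢ Set.Icc 0 εmax) fun x : E × ℝ × ℝ =>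
    ‖truncModified p q (field f x.2.2 p) (fun j => a j x.2.2) x.2.1 x.1
      - fieldNet f RF x.1 x.2.1 x.2.2‖ₑ

/-- `δ_g`: the supremum norm of `g - g_θ`. -/
def deltaG (f : ℝ → E → E) (p : ℕ) (R : ℝ → ℝ → E → ℝ → E) (RF : E → ℝ → ℝ → E)
    (Ω : Set E) (εmax : ℝ) : ℝ≥0∞ :=
  supNorm (Set.Icc 0 (2 * Real.pi) ×ˢ Ω ×ˢ Ω ×ˢ Set.Ioc 0 εmax) fun x : ℝ × E × E × ℝ =>
    ‖g f p x.1 x.2.1 x.2.2.1 x.2.2.2 - gNet f R RF x.1 x.2.1 x.2.2.1 x.2.2.2‖ₑ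

end LearningErrors

end

end MicroMacro

open MicroMacro

namespace MicroMacro

open Set Filter Topology

section Smooth

variable {X F : Type} [NormedAddCommGroup X] [NormedSpace ℝ X]
  [NormedAddCommGroup F] [NormedSpace ℝ F]

/-- Differentiation under the integral sign for a smooth integrand on an open set of parameters. -/
theorem hasFDerivAt_integral_unit {u : ℝ × X → F} {s : Set X} (hs : IsOpen s)
    (hu : ContDiffOn ℝ ∞ u (univ ×ˢ s)) {x : X} (hx : x ∈ s) :
    HasFDerivAt (fun x => ∫ t in (0 : ℝ)..1, u (t, x))
      (∫ t in (0 : ℝ)..1, (fderiv ℝ u (t, x)).comp (ContinuousLinearMap.inr ℝ ℝ X)) x := by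
  have ho : IsOpen ((univ : Set ℝ) ×ˢ s) := isOpen_univ.prod hs
  have hfd : ContinuousOn (fderiv ℝ u) (univ ×ˢ s) :=
    ((contDiffOn_infty_iff_fderiv_of_isOpen ho).1 hu).2.continuousOn
  have hline : ∀ y ∈ s, Continuous fun t : ℝ => fderiv ℝ u (t, y) := fun y hy =>
    hfd.comp_continuous (by fun_prop) fun t => ⟨mem_univ _, hy⟩
  have hlineu : ∀ y ∈ s, Continuous fun t : ℝ => u (t, y) := fun y hy =>
    hu.continuousOn.comp_continuous (by fun_prop) fun t => ⟨mem_univ _, hy⟩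
  obtain ⟨M, hM⟩ := isCompact_Icc.exists_bound_of_continuousOn
    (s := Icc (0 : ℝ) 1) (hline x hx).continuousOn
  have hopen : IsOpen ((univ ×ˢ s) ∩ (fun q => ‖fderiv ℝ u q‖) ⁻¹' Iio (M + 1)) :=
    (continuous_norm.comp_continuousOn hfd).isOpen_inter_preimage ho isOpen_Iio
  obtain ⟨a, b, -, hb, ha, hxb, hab⟩ := generalized_tube_lemma (isCompact_Icc (a := (0 : ℝ)) (b := 1))
    (isCompact_singleton (x := x)) hopen (by
      rintro ⟨t, y⟩ ⟨ht, hy⟩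
      obtain rfl : y = x := hy
      exact ⟨⟨mem_univ _, hx⟩, lt_of_le_of_lt (hM t ht) (lt_add_one M)⟩)
  refine intervalIntegral.hasFDerivAt_integral_of_dominated_of_fderiv_le
    (F := fun x t => u (t, x))
    (F' := fun x t => (fderiv ℝ u (t, x)).comp (ContinuousLinearMap.inr ℝ ℝ X))
    (bound := fun _ => (M + 1) * ‖ContinuousLinearMap.inr ℝ ℝ X‖)
    (hb.mem_nhds (hxb rfl)) ?_ ?_ ?_ ?_ ?_ ?_
  · filter_upwards [hs.mem_nhds hx] with y hy
    exact (hlineu y hy).aestronglyMeasurable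
  · exact (hlineu x hx).intervalIntegrable _ _
  · exact ((hline x hx).clm_comp continuous_const).aestronglyMeasurable
  · refine Eventually.of_forall fun t ht y hy => ?_
    rw [uIoc_of_le zero_le_one] at ht
    have := (hab (show (t, y) ∈ a ×ˢ b from ⟨ha (Ioc_subset_Icc_self ht), hy⟩)).2
    exact (ContinuousLinearMap.opNorm_comp_le _ _).trans
      (mul_le_mul_of_nonneg_right (le_of_lt this) (norm_nonneg _))
  · exact intervalIntegrable_const
  · refine Eventually.of_forall fun t ht y hy => ?_
    rw [uIoc_of_le zero_le_one] at ht
    have hmem := (hab (show (t, y) ∈ a ×ˢ b from ⟨ha (Ioc_subset_Icc_self ht), hy⟩)).1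
    have h1 : HasFDerivAt u (fderiv ℝ u (t, y)) (t, y) :=
      ((hu.contDiffAt (ho.mem_nhds hmem)).differentiableAt (by simp)).hasFDerivAt
    exact h1.comp y (hasFDerivAt_prodMk_right t y)

theorem contDiffOn_integral_unit_nat (n : ℕ) : ∀ {F : Type} [NormedAddCommGroup F]
    [NormedSpace ℝ F] {u : ℝ × X → F} {s : Set X}, IsOpen s →
    ContDiffOn ℝ ∞ u (univ ×ˢ s) → ContDiffOn ℝ n (fun x => ∫ t in (0 : ℝ)..1, u (t, x)) s := by
  induction n with
  | zero =>
    intro F _ _ u s hs hu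
    exact contDiffOn_zero.2 fun x hx =>
      (hasFDerivAt_integral_unit hs hu hx).continuousAt.continuousWithinAt
  | succ n ih =>
    intro F _ _ u s hs hu
    have ho : IsOpen ((univ : Set ℝ) ×ˢ s) := isOpen_univ.prod hs
    push_cast
    refine (contDiffOn_succ_iff_fderiv_of_isOpen hs).2 ⟨fun x hx =>
      (hasFDerivAt_integral_unit hs hu hx).differentiableAt.differentiableWithinAt,
      fun h => absurd h (by simp), ?_⟩
    refine (ih (u := fun q => (fderiv ℝ u q).comp (ContinuousLinearMap.inr ℝ ℝ X)) hs
      ?_).congr fun x hx => (hasFDerivAt_integral_unit hs hu hx).fderiv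
    exact (((contDiffOn_infty_iff_fderiv_of_isOpen ho).1 hu).2).clm_comp contDiffOn_const

theorem contDiffOn_integral_unit {u : ℝ × X → F} {s : Set X} (hs : IsOpen s)
    (hu : ContDiffOn ℝ ∞ u (univ ×ˢ s)) :
    ContDiffOn ℝ ∞ (fun x => ∫ t in (0 : ℝ)..1, u (t, x)) s :=
  contDiffOn_infty.2 fun n => contDiffOn_integral_unit_nat n hs hu

theorem contDiffOn_integral_upper {u : ℝ × X → F} {s : Set X} (hs : IsOpen s)
    (hu : ContDiffOn ℝ ∞ u (univ ×ˢ s)) :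
    ContDiffOn ℝ ∞ (fun q : ℝ × X => ∫ t in (0 : ℝ)..q.1, u (t, q.2)) (univ ×ˢ s) := by
  have ho : IsOpen ((univ : Set ℝ) ×ˢ s) := isOpen_univ.prod hs
  have h := contDiffOn_integral_unit (X := ℝ × X) (u := fun r => u (r.2.1 * r.1, r.2.2)) ho
    (hu.comp (by fun_prop) fun r hr => ⟨mem_univ _, hr.2.2⟩)
  refine ((contDiff_fst.contDiffOn).smul h).congr fun q _ => ?_
  have := intervalIntegral.smul_integral_comp_mul_left (a := 0) (b := 1)
    (fun t => u (t, q.2)) q.1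
  simpa using this.symm

theorem contDiffOn_avg {u : ℝ × X → F} {s : Set X} (hs : IsOpen s)
    (hu : ContDiffOn ℝ ∞ u (univ ×ˢ s)) :
    ContDiffOn ℝ ∞ (fun x => avg fun t => u (t, x)) s := by
  have h := (contDiffOn_integral_upper hs hu).comp (s := s)
    (f := fun x : X => ((2 * Real.pi : ℝ), x)) (by fun_prop) fun x hx => ⟨mem_univ _, hx⟩
  exact contDiffOn_const.smul h

/-- The partial derivative in the last variable of a smooth map is smooth. -/
theorem contDiffOn_partial_fderiv {Y Z : Type} [NormedAddCommGroup Y] [NormedSpace ℝ Y]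
    [NormedAddCommGroup Z] [NormedSpace ℝ Z] {u : Y × Z → F} {s : Set (Y × Z)} (hs : IsOpen s)
    (hu : ContDiffOn ℝ ∞ u s) :
    ContDiffOn ℝ ∞ (fun q : Y × Z => fderiv ℝ (fun z => u (q.1, z)) q.2) s := by
  refine (((contDiffOn_infty_iff_fderiv_of_isOpen hs).1 hu).2.clm_comp
    (contDiffOn_const (c := ContinuousLinearMap.inr ℝ Y Z))).congr fun q hq => ?_
  have h1 : HasFDerivAt u (fderiv ℝ u q) q :=
    ((hu.contDiffAt (hs.mem_nhds hq)).differentiableAt (by simp)).hasFDerivAt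
  exact (h1.comp (f := fun z => (q.1, z)) q.2 (hasFDerivAt_prodMk_right q.1 q.2)).fderiv

/-- A smooth map is Lipschitz on compact sets. -/
theorem exists_lipschitz_of_compact {u : X → F} {s K : Set X} (hs : IsOpen s)
    (hu : ContDiffOn ℝ ∞ u s) (hK : IsCompact K) (hKs : K ⊆ s) :
    ∃ L : ℝ, 0 < L ∧ ∀ x ∈ K, ∀ y ∈ K, ‖u x - u y‖ ≤ L * ‖x - y‖ := by
  have hloc : LocallyLipschitzOn K u := by
    intro x hx
    obtain ⟨L, t, ht, hL⟩ := ((hu.contDiffAt (hs.mem_nhds (hKs hx))).of_le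
      (m := 1) (by exact_mod_cast le_top)).exists_lipschitzOnWith
    exact ⟨L, t, mem_nhdsWithin_of_mem_nhds ht, hL⟩
  obtain ⟨L, hL⟩ := hloc.exists_lipschitzOnWith_of_compact hK
  refine ⟨L + 1, by positivity, fun x hx y hy => (hL.norm_sub_le hx hy).trans ?_⟩
  gcongr
  simp

theorem exists_bound_of_compact {u : X → F} {s K : Set X}
    (hu : ContDiffOn ℝ ∞ u s) (hK : IsCompact K) (hKs : K ⊆ s) :
    ∃ M : ℝ, 0 < M ∧ ∀ x ∈ K, ‖u x‖ ≤ M := by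
  obtain ⟨M, hM⟩ := hK.exists_bound_of_continuousOn (hu.continuousOn.mono hKs)
  exact ⟨|M| + 1, by positivity, fun x hx => (hM x hx).trans (by linarith [le_abs_self M])⟩

end Smooth

section Expansion

variable {F : Type} [NormedAddCommGroup F] [NormedSpace ℝ F]

/-- The coefficients of the primitive, with value `a` at `0`, of `∑ h ^ k • c k`. -/
noncomputable def primCoeff (a : F) (c : ℕ → F) : ℕ → F
  | 0 => a
  | k + 1 => ((k : ℝ) + 1)⁻¹ • c k

theorem hasDerivAt_sum_primCoeff (a : F) (c : ℕ → F) (m : ℕ) (t : ℝ) :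
    HasDerivAt (fun h : ℝ => ∑ k ∈ Finset.range (m + 1), h ^ k • primCoeff a c k)
      (∑ k ∈ Finset.range m, t ^ k • c k) t := by
  have h1 : HasDerivAt (fun h : ℝ => ∑ k ∈ Finset.range m, h ^ (k + 1) • primCoeff a c (k + 1))
      (∑ k ∈ Finset.range m, t ^ k • c k) t := by
    refine HasDerivAt.fun_sum fun k _ => ?_
    have h2 := (hasDerivAt_pow (k + 1) t).smul_const (primCoeff a c (k + 1))
    convert h2 using 1
    rw [primCoeff, smul_smul]
    congr 1
    push_cast
    have : (k : ℝ) + 1 ≠ 0 := by positivity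
    field_simp
  simp only [Finset.sum_range_succ', pow_zero, one_smul]
  exact h1.add_const _

/-- Integration of an expansion in powers of `h`. -/
theorem expansion_of_deriv {φ φ' : ℝ → F} {c : ℕ → F} {h C : ℝ} {m : ℕ} (hh : 0 ≤ h) (hC : 0 ≤ C)
    (hd : ∀ t ∈ Icc 0 h, HasDerivWithinAt φ (φ' t) (Icc 0 h) t)
    (hb : ∀ t ∈ Icc 0 h, ‖φ' t - ∑ k ∈ Finset.range m, t ^ k • c k‖ ≤ C * t ^ m) :
    ‖φ h - ∑ k ∈ Finset.range (m + 1), h ^ k • primCoeff (φ 0) c k‖ ≤ C * h ^ (m + 1) := by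
  have key := norm_image_sub_le_of_norm_deriv_le_segment' (a := 0) (b := h) (C := C * h ^ m)
    (f := fun t => φ t - ∑ k ∈ Finset.range (m + 1), t ^ k • primCoeff (φ 0) c k)
    (f' := fun t => φ' t - ∑ k ∈ Finset.range m, t ^ k • c k)
    (fun t ht => (hd t ht).sub (hasDerivAt_sum_primCoeff (φ 0) c m t).hasDerivWithinAt)
    (fun t ht => (hb t (Ico_subset_Icc_self ht)).trans (by
      have := ht.1
      have := ht.2.le
      gcongr)) h (right_mem_Icc.2 hh)
  have h0 : (∑ k ∈ Finset.range (m + 1), (0 : ℝ) ^ k • primCoeff (φ 0) c k) = φ 0 := by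
    simp [Finset.sum_range_succ', primCoeff]
  simp only [h0, sub_self, sub_zero] at key
  exact key.trans (by rw [pow_succ]; linarith)

/-- If a polynomial of degree less than `m` is `O(h ^ m)` as `h → 0⁺`, its coefficients vanish. -/
theorem coeff_eq_zero_of_bound (m : ℕ) : ∀ {c : ℕ → F} {C h₀ : ℝ}, 0 < h₀ →
    (∀ h ∈ Ioc 0 h₀, ‖∑ k ∈ Finset.range m, h ^ k • c k‖ ≤ C * h ^ m) → ∀ k < m, c k = 0 := by
  induction m with
  | zero => intro c C h₀ _ _ k hk; exact absurd hk (Nat.not_lt_zero k)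
  | succ m ih =>
    intro c C h₀ hh₀ hb
    have hc0 : c 0 = 0 := by
      have ht1 : Tendsto (fun h : ℝ => ∑ k ∈ Finset.range (m + 1), h ^ k • c k) (𝓝[>] 0)
          (𝓝 (∑ k ∈ Finset.range (m + 1), (0 : ℝ) ^ k • c k)) := by
        refine Tendsto.mono_left ?_ nhdsWithin_le_nhds
        exact Continuous.tendsto (by fun_prop) 0
      have ht2 : Tendsto (fun h : ℝ => C * h ^ (m + 1)) (𝓝[>] 0) (𝓝 (C * 0 ^ (m + 1))) := by
        refine Tendsto.mono_left ?_ nhdsWithin_le_nhds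
        exact Continuous.tendsto (by fun_prop) 0
      have := le_of_tendsto_of_tendsto ht1.norm ht2 (by
        filter_upwards [Ioc_mem_nhdsGT hh₀] with h hh using hb h hh)
      simpa [Finset.sum_range_succ'] using this
    have hstep := ih (c := fun k => c (k + 1)) (C := C) hh₀ fun h hh => by
      have h1 := hb h hh
      rw [Finset.sum_range_succ', hc0, smul_zero, add_zero] at h1
      have h2 : (∑ k ∈ Finset.range m, h ^ (k + 1) • c (k + 1)) =
          h • ∑ k ∈ Finset.range m, h ^ k • c (k + 1) := by
        rw [Finset.smul_sum]
        exact Finset.sum_congr rfl fun k _ => by rw [smul_smul, pow_succ']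
      rw [h2, norm_smul, Real.norm_of_nonneg hh.1.le, pow_succ', mul_left_comm] at h1
      exact le_of_mul_le_mul_left h1 hh.1
    intro k hk
    cases k with
    | zero => exact hc0
    | succ k => exact hstep k (Nat.lt_of_succ_lt_succ hk)

/-- Uniform Taylor expansion in the first variable of a smooth map. -/
theorem uniform_taylor {X : Type} [NormedAddCommGroup X] [NormedSpace ℝ X]
    {W : Set (ℝ × X)} (hW : IsOpen W) {K : Set X} (hK : IsCompact K) {h₁ : ℝ} 
    (hKW : Icc 0 h₁ ×ˢ K ⊆ W) (m : ℕ) : ∀ {D : ℝ × X → F}, ContDiffOn ℝ ∞ D W →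
    ∃ c : ℕ → X → F, ∃ C > (0 : ℝ), ∀ h ∈ Icc 0 h₁, ∀ x ∈ K,
      ‖D (h, x) - ∑ k ∈ Finset.range m, h ^ k • c k x‖ ≤ C * h ^ m := by
  induction m with
  | zero =>
    intro D hD
    obtain ⟨M, hM, hb⟩ := exists_bound_of_compact hD (isCompact_Icc.prod hK) hKW
    exact ⟨fun _ _ => 0, M, hM, fun h hh x hx => by simpa using hb (h, x) ⟨hh, hx⟩⟩
  | succ m ih =>
    intro D hD
    obtain ⟨c, C, hC, hb⟩ := ih (D := fun q => fderiv ℝ D q (1, 0))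
      (((contDiffOn_infty_iff_fderiv_of_isOpen hW).1 hD).2.clm_apply contDiffOn_const)
    refine ⟨fun k x => primCoeff (D (0, x)) (fun j => c j x) k, C, hC, fun h hh x hx => ?_⟩
    refine expansion_of_deriv (φ := fun t => D (t, x)) hh.1 hC.le (fun t ht => ?_)
      (fun t ht => hb t ⟨ht.1, ht.2.trans hh.2⟩ x hx)
    have h1 : HasFDerivAt D (fderiv ℝ D (t, x)) (t, x) :=
      ((hD.contDiffAt (hW.mem_nhds (hKW ⟨⟨ht.1, ht.2.trans hh.2⟩, hx⟩))).differentiableAt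
        (by simp)).hasFDerivAt
    exact (h1.comp_hasDerivAt t ((hasDerivAt_id t).prodMk (hasDerivAt_const t x))).hasDerivWithinAt

/-- Uniform Taylor expansion of a smooth function along the solutions of a smooth system. -/
theorem uniform_taylor_solution {P V : Type} [NormedAddCommGroup P] [NormedSpace ℝ P]
    [NormedAddCommGroup V] [NormedSpace ℝ V] {O : Set (ℝ × P × V)} (hO : IsOpen O)
    {G : ℝ × P × V → V} (hG : ContDiffOn ℝ ∞ G O) {K : Set (ℝ × P × V)} (hK : IsCompact K)
    (hKO : K ⊆ O) (m : ℕ) : ∀ {u : ℝ × P × V → F}, ContDiffOn ℝ ∞ u O →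
    ∃ c : ℕ → P × V → F, ∃ C > (0 : ℝ), ∀ (h : ℝ) (p : P) (z : ℝ → V), 0 ≤ h →
      IsSolutionOn (fun t x => G (t, p, x)) 0 h z → (∀ t ∈ Icc 0 h, (t, p, z t) ∈ K) →
      ‖u (h, p, z h) - ∑ k ∈ Finset.range m, h ^ k • c k (p, z 0)‖ ≤ C * h ^ m := by
  induction m with
  | zero =>
    intro u hu
    obtain ⟨M, hM, hb⟩ := exists_bound_of_compact hu hK hKO
    exact ⟨fun _ _ => 0, M, hM, fun h p z hh _ hz => by simpa using hb _ (hz h (right_mem_Icc.2 hh))⟩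
  | succ m ih =>
    intro u hu
    obtain ⟨c, C, hC, hb⟩ := ih (u := fun q => fderiv ℝ u q (1, 0, G q))
      (((contDiffOn_infty_iff_fderiv_of_isOpen hO).1 hu).2.clm_apply
        (contDiffOn_const.prodMk (contDiffOn_const.prodMk hG)))
    refine ⟨fun k x => primCoeff (u (0, x)) (fun j => c j x) k, C, hC, fun h p z hh hz hzK => ?_⟩
    refine expansion_of_deriv (φ := fun t => u (t, p, z t))
      (φ' := fun t => fderiv ℝ u (t, p, z t) (1, 0, G (t, p, z t))) hh hC.le (fun t ht => ?_)
      (fun t ht => ?_)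
    · have h1 : HasFDerivAt u (fderiv ℝ u (t, p, z t)) (t, p, z t) :=
        ((hu.contDiffAt (hO.mem_nhds (hKO (hzK t ht)))).differentiableAt (by simp)).hasFDerivAt
      exact h1.comp_hasDerivWithinAt t ((hasDerivWithinAt_id t _).prodMk
        ((hasDerivWithinAt_const t _ p).prodMk (hz t ht)))
    · refine hb t p z ht.1 (fun σ hσ => ?_) fun σ hσ => hzK σ ⟨hσ.1, hσ.2.trans ht.2⟩
      exact (hz σ ⟨hσ.1, hσ.2.trans ht.2⟩).mono (Icc_subset_Icc_right ht.2)

end Expansion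

section Stages

variable {V : Type} [NormedAddCommGroup V] [NormedSpace ℝ V] {s : ℕ}

/-- A bound for the coefficients of a Runge-Kutta method. -/
noncomputable def ButcherTableau.bound (tab : ButcherTableau s) : ℝ :=
  1 + ∑ i, ∑ j, |tab.A i j| + ∑ j, |tab.b j| + ∑ j, |tab.c j|

theorem ButcherTableau.one_le_bound (tab : ButcherTableau s) : 1 ≤ tab.bound := by
  have h1 : 0 ≤ ∑ i, ∑ j, |tab.A i j| := by positivity
  have h2 : 0 ≤ ∑ j, |tab.b j| := by positivity
  have h3 : 0 ≤ ∑ j, |tab.c j| := by positivity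
  unfold ButcherTableau.bound
  linarith

theorem ButcherTableau.bound_pos (tab : ButcherTableau s) : 0 < tab.bound :=
  one_pos.trans_le tab.one_le_bound

theorem ButcherTableau.sum_abs_A_le (tab : ButcherTableau s) (i : Fin s) :
    ∑ j, |tab.A i j| ≤ tab.bound := by
  have h1 : ∑ j, |tab.A i j| ≤ ∑ i, ∑ j, |tab.A i j| :=
    Finset.single_le_sum (f := fun i => ∑ j, |tab.A i j|) (fun i _ => by positivity)
      (Finset.mem_univ i)
  have h2 : 0 ≤ ∑ j, |tab.b j| := by positivity
  have h3 : 0 ≤ ∑ j, |tab.c j| := by positivity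
  unfold ButcherTableau.bound
  linarith

theorem ButcherTableau.sum_abs_b_le (tab : ButcherTableau s) : ∑ j, |tab.b j| ≤ tab.bound := by
  have h1 : 0 ≤ ∑ i, ∑ j, |tab.A i j| := by positivity
  have h3 : 0 ≤ ∑ j, |tab.c j| := by positivity
  unfold ButcherTableau.bound
  linarith

theorem ButcherTableau.abs_c_le (tab : ButcherTableau s) (j : Fin s) : |tab.c j| ≤ tab.bound := by
  have h1 : 0 ≤ ∑ i, ∑ j, |tab.A i j| := by positivity
  have h2 : 0 ≤ ∑ j, |tab.b j| := by positivity
  have h3 : |tab.c j| ≤ ∑ j, |tab.c j| :=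
    Finset.single_le_sum (f := fun j => |tab.c j|) (fun i _ => by positivity) (Finset.mem_univ j)
  unfold ButcherTableau.bound
  linarith

theorem norm_weighted_sum_le {a : Fin s → ℝ} {κ B : ℝ} (ha : ∑ j, |a j| ≤ κ) (hB : 0 ≤ B)
    {k : Fin s → V} (hk : ∀ j, ‖k j‖ ≤ B) : ‖∑ j, a j • k j‖ ≤ κ * B :=
  calc ‖∑ j, a j • k j‖ ≤ ∑ j, ‖a j • k j‖ := norm_sum_le _ _
    _ ≤ ∑ j, |a j| * B := Finset.sum_le_sum fun j _ => by
        rw [norm_smul, Real.norm_eq_abs]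
        exact mul_le_mul_of_nonneg_left (hk j) (abs_nonneg _)
    _ = (∑ j, |a j|) * B := (Finset.sum_mul _ _ _).symm
    _ ≤ κ * B := mul_le_mul_of_nonneg_right ha hB

/-- The map whose fixed points are the stage values. -/
def stageMap (tab : ButcherTableau s) (G : ℝ → V → V) (t h : ℝ) (y : V) (Y : Fin s → V) :
    Fin s → V :=
  fun i => y + h • ∑ j, tab.A i j • G (t + tab.c j * h) (Y j)

/-- Existence of the stage values, and their distance to the Picard iterates. -/
theorem exists_stages [CompleteSpace V] (tab : ButcherTableau s) {G : ℝ → V → V} {t h δ M L : ℝ}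
    {y : V} (hh : 0 ≤ h) (hδ : 0 ≤ δ) (hM : 0 ≤ M) (hL : 0 ≤ L)
    (hGM : ∀ j, ∀ x ∈ Metric.closedBall y δ, ‖G (t + tab.c j * h) x‖ ≤ M)
    (hGL : ∀ j, ∀ x ∈ Metric.closedBall y δ, ∀ x' ∈ Metric.closedBall y δ,
      ‖G (t + tab.c j * h) x - G (t + tab.c j * h) x'‖ ≤ L * ‖x - x'‖)
    (h1 : h * tab.bound * M ≤ δ) (h2 : h * tab.bound * L ≤ 1 / 2) :
    ∃ Y : Fin s → V, IsStages tab G t h y Y ∧ (∀ i, ‖Y i - y‖ ≤ h * tab.bound * M) ∧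
      ∀ n, (∀ i, ‖(stageMap tab G t h y)^[n] (fun _ => y) i - y‖ ≤ δ) ∧
        ∀ i, ‖Y i - (stageMap tab G t h y)^[n] (fun _ => y) i‖ ≤
          (h * tab.bound * L) ^ n * (h * tab.bound * M) := by
  set Ψ := stageMap tab G t h y with hΨ
  set B : Set (Fin s → V) := Metric.closedBall (fun _ => y) δ with hB
  have hκ := tab.bound_pos
  have hmemB : ∀ Y : Fin s → V, Y ∈ B ↔ ∀ i, ‖Y i - y‖ ≤ δ := fun Y => by
    rw [hB, mem_closedBall_iff_norm, pi_norm_le_iff_of_nonneg hδ]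
    rfl
  have hball : ∀ Y ∈ B, ∀ i, Y i ∈ Metric.closedBall y δ := fun Y hY i =>
    mem_closedBall_iff_norm.2 ((hmemB Y).1 hY i)
  have hstep : ∀ Y ∈ B, ∀ i, ‖Ψ Y i - y‖ ≤ h * tab.bound * M := fun Y hY i => by
    simp only [hΨ, stageMap, add_sub_cancel_left, norm_smul, Real.norm_of_nonneg hh, mul_assoc]
    exact mul_le_mul_of_nonneg_left (norm_weighted_sum_le (tab.sum_abs_A_le i) hM
      fun j => hGM j _ (hball Y hY j)) hh
  have hmaps : MapsTo Ψ B B := fun Y hY => (hmemB _).2 fun i => (hstep Y hY i).trans h1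
  have hlip : ∀ Y ∈ B, ∀ Y' ∈ B, ∀ D : ℝ, 0 ≤ D → (∀ j, ‖Y j - Y' j‖ ≤ D) →
      ∀ i, ‖Ψ Y i - Ψ Y' i‖ ≤ h * tab.bound * L * D := fun Y hY Y' hY' D hD hYY i => by
    have : Ψ Y i - Ψ Y' i = h • ∑ j, tab.A i j •
        (G (t + tab.c j * h) (Y j) - G (t + tab.c j * h) (Y' j)) := by
      simp only [hΨ, stageMap, smul_sub, Finset.sum_sub_distrib, add_sub_add_left_eq_sub]
    rw [this, norm_smul, Real.norm_of_nonneg hh, mul_assoc, mul_assoc]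
    refine mul_le_mul_of_nonneg_left (norm_weighted_sum_le (tab.sum_abs_A_le i) (by positivity)
      fun j => (hGL j _ (hball Y hY j) _ (hball Y' hY' j)).trans ?_) hh
    exact mul_le_mul_of_nonneg_left (hYY j) hL
  have hcontr : ContractingWith (1 / 2) (hmaps.restrict Ψ B B) := by
    refine ⟨by norm_num, LipschitzWith.of_dist_le_mul fun Y Y' => ?_⟩
    rw [Subtype.dist_eq, Subtype.dist_eq, dist_eq_norm, dist_eq_norm,
      pi_norm_le_iff_of_nonneg (by positivity)]
    intro i
    refine (hlip Y.1 Y.2 Y'.1 Y'.2 _ (norm_nonneg _) (norm_le_pi_norm (Y.1 - Y'.1)) i).trans ?_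
    refine mul_le_mul_of_nonneg_right (h2.trans ?_) (norm_nonneg _)
    simp
  have h0 : (fun _ => y : Fin s → V) ∈ B := (hmemB _).2 fun i => by simpa using hδ
  obtain ⟨Y, hYB, hY, -, -⟩ := hcontr.exists_fixedPoint' Metric.isClosed_closedBall.isComplete
    hmaps h0 (edist_ne_top _ _)
  have hYfix : ∀ i, Y i = Ψ Y i := fun i => (congrFun hY i).symm
  refine ⟨Y, hYfix, fun i => ?_, fun n => ?_⟩
  · rw [hYfix]
    exact hstep Y hYB i
  · have hitB : ∀ n, Ψ^[n] (fun _ => y) ∈ B := fun n => hmaps.iterate n h0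
    refine ⟨(hmemB _).1 (hitB n), ?_⟩
    induction n with
    | zero =>
      intro i
      rw [hYfix]
      simpa using hstep Y hYB i
    | succ n ih =>
      intro i
      rw [Function.iterate_succ_apply', hYfix i, pow_succ', mul_assoc]
      exact hlip Y hYB _ (hitB n) _ (by positivity) ih i

end Stages

section LocalError

variable {P V : Type} [NormedAddCommGroup P] [NormedSpace ℝ P]
  [NormedAddCommGroup V] [NormedSpace ℝ V] {s : ℕ}

/-- The Picard iterates for the stage values, as functions of the step size, the parameter and the
initial value. -/
def stageIter (tab : ButcherTableau s) (H : ℝ → ℝ → P → V → V) (n : ℕ) (q : ℝ × P × V) :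
    Fin s → V :=
  (stageMap tab (fun t => H q.1 t q.2.1) 0 q.1 q.2.2)^[n] (fun _ => q.2.2)

omit [NormedAddCommGroup P] [NormedSpace ℝ P] in
theorem stageIter_zero_step (tab : ButcherTableau s) (H : ℝ → ℝ → P → V → V) (n : ℕ) (x : P × V) :
    stageIter tab H n (0, x) = fun _ => x.2 := by
  cases n with
  | zero => rfl
  | succ n =>
    rw [stageIter, Function.iterate_succ_apply']
    ext i
    simp [stageMap]

theorem exists_contDiffOn_stageIter (tab : ButcherTableau s) {H : ℝ → ℝ → P → V → V}
    {O : Set (ℝ × ℝ × P × V)} (hO : IsOpen O)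
    (hH : ContDiffOn ℝ ∞ (fun q : ℝ × ℝ × P × V => H q.1 q.2.1 q.2.2.1 q.2.2.2) O)
    {K : Set (P × V)} (hKO : ∀ x ∈ K, ((0 : ℝ), (0 : ℝ), x) ∈ O) (n : ℕ) :
    ∃ W : Set (ℝ × P × V), IsOpen W ∧ (∀ x ∈ K, ((0 : ℝ), x) ∈ W) ∧
      ContDiffOn ℝ ∞ (stageIter tab H n) W ∧
      ∀ q ∈ W, ∀ j, (q.1, 0 + tab.c j * q.1, q.2.1, stageIter tab H n q j) ∈ O := by
  have shrink : ∀ n W, IsOpen W → (∀ x ∈ K, ((0 : ℝ), x) ∈ W) →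
      ContDiffOn ℝ ∞ (stageIter tab H n) W →
      ∃ W' : Set (ℝ × P × V), IsOpen W' ∧ (∀ x ∈ K, ((0 : ℝ), x) ∈ W') ∧
      ContDiffOn ℝ ∞ (stageIter tab H n) W' ∧
      ∀ q ∈ W', ∀ j, (q.1, 0 + tab.c j * q.1, q.2.1, stageIter tab H n q j) ∈ O := by
    intro n W hW hKW hn
    have hcont : ContinuousOn (fun q : ℝ × P × V => fun j : Fin s =>
        ((q.1, 0 + tab.c j * q.1, q.2.1, stageIter tab H n q j) : ℝ × ℝ × P × V)) W := by
      have := hn.continuousOn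
      fun_prop
    refine ⟨_, hcont.isOpen_inter_preimage hW (isOpen_set_pi (s := fun _ => O) finite_univ
      fun _ _ => hO), fun x hx => ⟨hKW x hx, fun j _ => ?_⟩, hn.mono inter_subset_left,
      fun q hq j => hq.2 j (mem_univ j)⟩
    simpa [stageIter_zero_step] using hKO x hx
  induction n with
  | zero =>
    refine shrink 0 univ isOpen_univ (fun _ _ => mem_univ _) ?_
    exact contDiffOn_pi.2 fun _ => by
      show ContDiffOn ℝ ∞ (fun q : ℝ × P × V => q.2.2) univ
      fun_prop
  | succ n ih =>
    obtain ⟨W, hW, hKW, hn, hWO⟩ := ih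
    refine shrink (n + 1) W hW hKW (contDiffOn_pi.2 fun i => ?_)
    have hcongr : (fun q => stageIter tab H (n + 1) q i) = fun q : ℝ × P × V =>
        q.2.2 + q.1 • ∑ j, tab.A i j • H q.1 (0 + tab.c j * q.1) q.2.1 (stageIter tab H n q j) := by
      funext q
      rw [stageIter, Function.iterate_succ_apply']
      rfl
    rw [hcongr]
    have hj : ∀ j, ContDiffOn ℝ ∞ (fun q : ℝ × P × V =>
        H q.1 (0 + tab.c j * q.1) q.2.1 (stageIter tab H n q j)) W := fun j => by
      have h1 : ContDiffOn ℝ ∞ (fun q : ℝ × P × V => stageIter tab H n q j) W :=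
        contDiffOn_pi.1 hn j
      exact hH.comp (f := fun q : ℝ × P × V =>
        (q.1, 0 + tab.c j * q.1, q.2.1, stageIter tab H n q j)) (by fun_prop)
        fun q hq => hWO q hq j
    exact ContDiffOn.add (by fun_prop) (ContDiffOn.smul (by fun_prop)
      (ContDiffOn.sum fun j _ => contDiffOn_const.smul (hj j)))

end LocalError

section LocalError

variable {P V : Type} [NormedAddCommGroup P] [NormedSpace ℝ P] [FiniteDimensional ℝ P]
  [NormedAddCommGroup V] [NormedSpace ℝ V] [FiniteDimensional ℝ V] {s : ℕ}

omit [FiniteDimensional ℝ V] in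
/-- A smooth system has a local solution which stays close to its initial value. -/
theorem exists_local_solution [CompleteSpace V] {G : ℝ → V → V} {y : V} {δ M L : ℝ} (hδ : 0 < δ)
    (hM : 0 < M) (hL : 0 ≤ L)
    (hGM : ∀ t ∈ Icc 0 δ, ∀ x ∈ Metric.closedBall y δ, ‖G t x‖ ≤ M)
    (hGL : ∀ t ∈ Icc 0 δ, ∀ x ∈ Metric.closedBall y δ, ∀ x' ∈ Metric.closedBall y δ,
      ‖G t x - G t x'‖ ≤ L * ‖x - x'‖)
    (hGc : ∀ x ∈ Metric.closedBall y δ, ContinuousOn (fun t => G t x) (Icc 0 δ)) :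
    ∃ r > 0, ∃ z : ℝ → V, r ≤ δ ∧ z 0 = y ∧ IsSolutionOn G 0 r z ∧
      ∀ t ∈ Icc 0 r, ‖z t - y‖ ≤ δ := by
  set r₁ := min δ (δ / M) with hr₁
  have hr₁p : 0 < r₁ := lt_min hδ (div_pos hδ hM)
  have hsub : Icc 0 r₁ ⊆ Icc 0 δ := Icc_subset_Icc_right (min_le_left _ _)
  have hpl : IsPicardLindelof G (tmin := 0) (tmax := r₁) ⟨0, left_mem_Icc.2 hr₁p.le⟩ y
      ⟨δ, hδ.le⟩ 0 ⟨M, hM.le⟩ ⟨L, hL⟩ :=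
    { lipschitzOnWith := fun t ht => LipschitzOnWith.of_dist_le_mul fun x hx x' hx' => by
        rw [dist_eq_norm, dist_eq_norm]
        exact hGL t (hsub ht) x hx x' hx'
      continuousOn := fun x hx => (hGc x hx).mono hsub
      norm_le := fun t ht x hx => hGM t (hsub ht) x hx
      mul_max_le := by
        have h2 : M * r₁ ≤ δ := by
          calc M * r₁ ≤ M * (δ / M) := mul_le_mul_of_nonneg_left (min_le_right _ _) hM.le
            _ = δ := by field_simp
        show M * max (r₁ - 0) (0 - 0) ≤ δ - 0
        simpa [max_eq_left hr₁p.le] using h2 }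
  obtain ⟨z, hz0, hz⟩ := hpl.exists_eq_forall_mem_Icc_hasDerivWithinAt₀
  have hz0' : z 0 = y := hz0
  have hcont : ContinuousWithinAt z (Icc 0 r₁) 0 := (hz 0 (left_mem_Icc.2 hr₁p.le)).continuousWithinAt
  have hev : ∀ᶠ t in 𝓝[Icc 0 r₁] 0, z t ∈ Metric.closedBall (z 0) δ :=
    hcont (Metric.closedBall_mem_nhds _ hδ)
  rw [nhdsWithin_Icc_eq_nhdsGE hr₁p, eventually_nhdsWithin_iff] at hev
  obtain ⟨η, hη, hev⟩ := Metric.eventually_nhds_iff.1 hev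
  have hr : min (η / 2) r₁ ≤ r₁ := min_le_right _ _
  refine ⟨min (η / 2) r₁, lt_min (half_pos hη) hr₁p, z, hr.trans (min_le_left _ _), hz0',
    fun t ht => (hz t ⟨ht.1, ht.2.trans hr⟩).mono (Icc_subset_Icc_right hr), fun t ht => ?_⟩
  have h1 : dist t 0 < η := by
    rw [Real.dist_0_eq_abs, abs_of_nonneg ht.1]
    linarith [ht.2.trans (min_le_left _ _)]
  have := hev h1 ht.1
  rwa [hz0', mem_closedBall_iff_norm] at this

/-- If the local error of a Runge-Kutta method is `O(h ^ m)` along every solution starting in the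
compact set `K` of parameters and states, then it is so uniformly on `K`. -/
theorem uniform_local_error (tab : ButcherTableau s) {H : ℝ → ℝ → P → V → V}
    {O : Set (ℝ × ℝ × P × V)} (hO : IsOpen O)
    (hH : ContDiffOn ℝ ∞ (fun q : ℝ × ℝ × P × V => H q.1 q.2.1 q.2.2.1 q.2.2.2) O)
    {K : Set (P × V)} (hK : IsCompact K) (hKO : ∀ x ∈ K, ((0 : ℝ), (0 : ℝ), x) ∈ O) (m : ℕ)
    (hloc : ∀ x ∈ K, ∀ (r : ℝ) (z : ℝ → V), 0 < r → z 0 = x.2 →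
      IsSolutionOn (fun t => H 0 t x.1) 0 r z →
      LocalErrorO tab (fun h t => H h t x.1) 0 z m) :
    ∃ C > (0 : ℝ), ∃ h₀ > (0 : ℝ), ∀ h ∈ Ioc 0 h₀, ∀ x ∈ K, ∃ Y : Fin s → V,
      IsStages tab (fun t => H h t x.1) 0 h x.2 Y ∧ (∀ i, ‖Y i - x.2‖ ≤ C * h) ∧
      ∀ z : ℝ → V, z 0 = x.2 → IsSolutionOn (fun t => H 0 t x.1) 0 h z →
        (∀ t ∈ Icc 0 h, (x.1, z t) ∈ K) →
        ‖z h - stepValue tab (fun t => H h t x.1) 0 h x.2 Y‖ ≤ C * h ^ m := by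
  have : CompleteSpace V := FiniteDimensional.complete ℝ V
  have : ProperSpace P := FiniteDimensional.proper ℝ P
  have : ProperSpace V := FiniteDimensional.proper ℝ V
  set K₀ : Set (ℝ × ℝ × P × V) := (fun x : P × V => ((0 : ℝ), (0 : ℝ), x)) '' K with hK₀
  have hK₀c : IsCompact K₀ := hK.image (by fun_prop)
  obtain ⟨δ, hδ, hδO⟩ := hK₀c.exists_cthickening_subset_open hO (by
    rintro _ ⟨x, hx, rfl⟩
    exact hKO x hx)
  have hKδ : IsCompact (Metric.cthickening δ K₀) := hK₀c.cthickening
  have hmem : ∀ x ∈ K, ∀ h t : ℝ, |h| ≤ δ → |t| ≤ δ → ∀ y ∈ Metric.closedBall x.2 δ,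
      (h, t, x.1, y) ∈ Metric.cthickening δ K₀ := by
    intro x hx h t hh ht y hy
    refine Metric.mem_cthickening_of_dist_le _ (0, 0, x) _ _ ⟨x, hx, rfl⟩ ?_
    simp only [Prod.dist_eq, Real.dist_0_eq_abs, dist_self]
    exact max_le hh (max_le ht (max_le hδ.le hy))
  obtain ⟨L, hL, hHL⟩ := exists_lipschitz_of_compact hO hH hKδ hδO
  obtain ⟨M, hM, hHM⟩ := exists_bound_of_compact hH hKδ hδO
  have hlip : ∀ x ∈ K, ∀ h t : ℝ, |h| ≤ δ → |t| ≤ δ → ∀ y ∈ Metric.closedBall x.2 δ,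
      ∀ y' ∈ Metric.closedBall x.2 δ, ‖H h t x.1 y - H h t x.1 y'‖ ≤ L * ‖y - y'‖ := by
    intro x hx h t hh ht y hy y' hy'
    have := hHL _ (hmem x hx h t hh ht y hy) _ (hmem x hx h t hh ht y' hy')
    simpa [Prod.norm_def] using this
  have hκ := tab.bound_pos
  -- expansion of the exact solutions
  have hslice : ContDiff ℝ ∞ (fun q : ℝ × P × V => ((0 : ℝ), q)) := by fun_prop
  obtain ⟨c, C₁, hC₁, hexact⟩ := uniform_taylor_solution (F := V)
    (O := (fun q : ℝ × P × V => ((0 : ℝ), q)) ⁻¹' O) (hO.preimage hslice.continuous)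
    (G := fun q => H 0 q.1 q.2.1 q.2.2)
    (hH.comp hslice.contDiffOn fun q hq => hq)
    (K := (fun q : ℝ × P × V => ((0 : ℝ), q)) ⁻¹' Metric.cthickening δ K₀)
    ((hKδ.image continuous_snd).of_isClosed_subset (hKδ.isClosed.preimage hslice.continuous)
      fun q hq => ⟨_, hq, rfl⟩)
    (fun q hq => hδO hq) m (u := fun q => q.2.2) (by fun_prop)
  -- expansion of the numerical solution
  obtain ⟨W, hW, hKW, hWs, hWO⟩ := exists_contDiffOn_stageIter tab hO hH hKO m
  obtain ⟨h₁, hh₁, hIW⟩ : ∃ h₁ > (0 : ℝ), Icc 0 h₁ ×ˢ K ⊆ W := by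
    obtain ⟨a, b, ha, -, ha0, hbK, hab⟩ := generalized_tube_lemma
      (isCompact_singleton (x := (0 : ℝ))) hK hW (by
        rintro ⟨t, x⟩ ⟨ht, hx⟩
        obtain rfl : t = 0 := ht
        exact hKW x hx)
    obtain ⟨η, hη, hb⟩ := Metric.isOpen_iff.1 ha 0 (ha0 rfl)
    refine ⟨η / 2, half_pos hη, fun q hq => hab ⟨hb ?_, hbK hq.2⟩⟩
    rw [Metric.mem_ball, Real.dist_0_eq_abs, abs_of_nonneg hq.1.1]
    linarith [hq.1.2]
  set D : ℝ × P × V → V := fun q =>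
    stepValue tab (fun t => H q.1 t q.2.1) 0 q.1 q.2.2 (stageIter tab H m q) with hD
  have hDs : ContDiffOn ℝ ∞ D W := by
    refine ContDiffOn.add (by fun_prop) (ContDiffOn.smul (by fun_prop)
      (ContDiffOn.sum fun j _ => contDiffOn_const.smul ?_))
    have h1 : ContDiffOn ℝ ∞ (fun q : ℝ × P × V => stageIter tab H m q j) W :=
      contDiffOn_pi.1 hWs j
    exact hH.comp (f := fun q : ℝ × P × V =>
      (q.1, 0 + tab.c j * q.1, q.2.1, stageIter tab H m q j)) (by fun_prop)
      fun q hq => hWO q hq j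
  obtain ⟨d, C₂, hC₂, hnum⟩ := uniform_taylor hW hK hIW m hDs
  -- the stage values
  set κ := tab.bound with hκdef
  obtain ⟨h₂, hh₂, hh₂δ, hh₂κ, hh₂M, hh₂L, hh₂h₁, hh₂1⟩ : ∃ h₂ > (0 : ℝ), h₂ ≤ δ ∧ κ * h₂ ≤ δ ∧
      h₂ * κ * M ≤ δ ∧ h₂ * κ * L ≤ 1 / 2 ∧ h₂ ≤ h₁ ∧ h₂ ≤ 1 := by
    refine ⟨min δ (min (δ / κ) (min (δ / (κ * M)) (min (1 / 2 / (κ * L)) (min h₁ 1)))),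
      by positivity, ?_, ?_, ?_, ?_, ?_, ?_⟩
    · exact min_le_left _ _
    · rw [mul_comm, ← le_div_iff₀ hκ]
      exact (min_le_right _ _).trans (min_le_left _ _)
    · rw [mul_assoc, ← le_div_iff₀ (by positivity)]
      exact (min_le_right _ _).trans ((min_le_right _ _).trans (min_le_left _ _))
    · rw [mul_assoc, ← le_div_iff₀ (by positivity)]
      exact (min_le_right _ _).trans ((min_le_right _ _).trans
        ((min_le_right _ _).trans (min_le_left _ _)))
    · exact (min_le_right _ _).trans ((min_le_right _ _).trans
        ((min_le_right _ _).trans ((min_le_right _ _).trans (min_le_left _ _))))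
    · exact (min_le_right _ _).trans ((min_le_right _ _).trans
        ((min_le_right _ _).trans ((min_le_right _ _).trans (min_le_right _ _))))
  set C₃ := h₂ * κ * L * ((κ * L) ^ m * (h₂ * κ * M)) with hC₃
  have hstages : ∀ h ∈ Ioc 0 h₂, ∀ x ∈ K, ∃ Y : Fin s → V,
      IsStages tab (fun t => H h t x.1) 0 h x.2 Y ∧ (∀ i, ‖Y i - x.2‖ ≤ κ * M * h) ∧
      ‖stepValue tab (fun t => H h t x.1) 0 h x.2 Y - D (h, x)‖ ≤ C₃ * h ^ m := by
    intro h hh x hx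
    have hh0 := hh.1.le
    have hhδ : |h| ≤ δ := by
      rw [abs_of_nonneg hh0]
      exact hh.2.trans hh₂δ
    have htδ : ∀ j, |0 + tab.c j * h| ≤ δ := fun j => by
      rw [zero_add, abs_mul, abs_of_nonneg hh0]
      exact (mul_le_mul (tab.abs_c_le j) hh.2 hh0 hκ.le).trans hh₂κ
    have hhM : h * κ * M ≤ δ := le_trans (by gcongr; exact hh.2) hh₂M
    obtain ⟨Y, hY, hYx, hYit⟩ := exists_stages tab (G := fun t => H h t x.1) (t := 0) (y := x.2)
      hh0 hδ.le hM.le hL.le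
      (fun j y hy => hHM _ (hmem x hx h _ hhδ (htδ j) y hy))
      (fun j y hy y' hy' => hlip x hx h _ hhδ (htδ j) y hy y' hy') hhM
      (le_trans (by gcongr; exact hh.2) hh₂L)
    refine ⟨Y, hY, fun i => (hYx i).trans_eq (by ring), ?_⟩
    have hdiff : stepValue tab (fun t => H h t x.1) 0 h x.2 Y - D (h, x) = h • ∑ j, tab.b j •
        (H h (0 + tab.c j * h) x.1 (Y j) - H h (0 + tab.c j * h) x.1 (stageIter tab H m (h, x) j)) := by
      simp only [hD, stepValue, smul_sub, Finset.sum_sub_distrib, add_sub_add_left_eq_sub]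
    rw [hdiff, norm_smul, Real.norm_of_nonneg hh0]
    have hb := norm_weighted_sum_le (tab.sum_abs_b_le)
      (B := L * ((h * κ * L) ^ m * (h * κ * M))) (by positivity)
      (k := fun j => H h (0 + tab.c j * h) x.1 (Y j) -
        H h (0 + tab.c j * h) x.1 (stageIter tab H m (h, x) j)) fun j => by
        refine (hlip x hx h _ hhδ (htδ j) (Y j) ?_ _ ?_).trans
          (mul_le_mul_of_nonneg_left ((hYit m).2 j) hL.le)
        · exact mem_closedBall_iff_norm.2 ((hYx j).trans hhM)
        · exact mem_closedBall_iff_norm.2 ((hYit m).1 j)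
    calc _ ≤ h * (κ * (L * ((h * κ * L) ^ m * (h * κ * M)))) := mul_le_mul_of_nonneg_left hb hh0
      _ = h * κ * L * ((κ * L) ^ m * (h * κ * M)) * h ^ m := by
        rw [mul_assoc h κ L, mul_pow]
        ring
      _ ≤ C₃ * h ^ m := by
        have := hh.2
        rw [hC₃]
        gcongr
  -- the coefficients of the two expansions agree
  have hcoef : ∀ x ∈ K, ∀ k < m, c k x = d k x := by
    intro x hx
    obtain ⟨r, hr, z, hrδ, hz0, hz, hzδ⟩ := exists_local_solution (G := fun t => H 0 t x.1)
      (y := x.2) hδ hM hL.le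
      (fun t ht y hy => hHM _ (hmem x hx 0 t (by simpa using hδ.le)
        (by rw [abs_of_nonneg ht.1]; exact ht.2) y hy))
      (fun t ht y hy y' hy' => hlip x hx 0 t (by simpa using hδ.le)
        (by rw [abs_of_nonneg ht.1]; exact ht.2) y hy y' hy')
      (fun y hy => by
        exact hH.continuousOn.comp (f := fun t : ℝ => ((0 : ℝ), t, x.1, y)) (by fun_prop)
          fun t ht => hδO (hmem x hx 0 t (by simpa using hδ.le)
            (by rw [abs_of_nonneg ht.1]; exact ht.2) y hy))
    obtain ⟨C₄, h₄, hh₄, ρ, hρ, hle⟩ := hloc x hx r z hr hz0 hz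
    have hpos : 0 < min (min r h₂) (min h₄ (ρ / (κ * M))) := by positivity
    have := coeff_eq_zero_of_bound m (c := fun k => c k x - d k x) (C := C₁ + C₄ + C₃ + C₂) hpos
      fun h hh => by
      have hhr : h ≤ r := hh.2.trans ((min_le_left _ _).trans (min_le_left _ _))
      have hhh₂ : h ≤ h₂ := hh.2.trans ((min_le_left _ _).trans (min_le_right _ _))
      have hhh₄ : h ≤ h₄ := hh.2.trans ((min_le_right _ _).trans (min_le_left _ _))
      have hhρ : κ * M * h ≤ ρ := by
        rw [mul_comm, ← le_div_iff₀ (by positivity)]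
        exact hh.2.trans ((min_le_right _ _).trans (min_le_right _ _))
      obtain ⟨Y, hY, hYx, hYD⟩ := hstages h ⟨hh.1, hhh₂⟩ x hx
      have e1 := hexact h x.1 z hh.1.le
        (fun t ht => (hz t ⟨ht.1, ht.2.trans hhr⟩).mono (Icc_subset_Icc_right hhr)) fun t ht => by
          refine hmem x hx 0 t (by simpa using hδ.le) ?_ _
            (mem_closedBall_iff_norm.2 (hzδ t ⟨ht.1, ht.2.trans hhr⟩))
          rw [abs_of_nonneg ht.1]
          exact (ht.2.trans hhr).trans hrδ
      rw [hz0] at e1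
      have e2 := hle h ⟨hh.1, hhh₄⟩ Y (by rw [hz0]; exact hY) fun i => by
        rw [hz0]
        exact (hYx i).trans hhρ
      rw [zero_add, hz0] at e2
      have e3 := hnum h ⟨hh.1.le, hhh₂.trans hh₂h₁⟩ x hx
      have hsum : ∑ k ∈ Finset.range m, h ^ k • (c k x - d k x) =
          (∑ k ∈ Finset.range m, h ^ k • c k (x.1, x.2)) - ∑ k ∈ Finset.range m, h ^ k • d k x := by
        simp only [smul_sub, Finset.sum_sub_distrib]
      rw [hsum]
      calc _ = ‖-(z h - ∑ k ∈ Finset.range m, h ^ k • c k (x.1, x.2))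
            + (z h - stepValue tab (fun t => H h t x.1) 0 h x.2 Y)
            + (stepValue tab (fun t => H h t x.1) 0 h x.2 Y - D (h, x))
            + (D (h, x) - ∑ k ∈ Finset.range m, h ^ k • d k x)‖ := by congr 1; abel
        _ ≤ C₁ * h ^ m + C₄ * h ^ m + C₃ * h ^ m + C₂ * h ^ m := by
          refine (norm_add_le _ _).trans (add_le_add ((norm_add_le _ _).trans (add_le_add
            ((norm_add_le _ _).trans (add_le_add ?_ e2)) hYD)) e3)
          rw [norm_neg]
          exact e1
        _ = _ := by ring
    exact fun k hk => sub_eq_zero.1 (this k hk)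
  refine ⟨κ * M + (C₁ + C₂ + C₃), by positivity, h₂, hh₂, fun h hh x hx => ?_⟩
  obtain ⟨Y, hY, hYx, hYD⟩ := hstages h hh x hx
  have hh0 := hh.1.le
  refine ⟨Y, hY, fun i => (hYx i).trans ?_, fun z hz0 hz hzK => ?_⟩
  · have : 0 ≤ (C₁ + C₂ + C₃) * h := by positivity
    linarith [add_mul (κ * M) (C₁ + C₂ + C₃) h]
  · have e1 := hexact h x.1 z hh0 hz fun t ht => by
      have hmem' := hmem (x.1, z t) (hzK t ht) 0 t (by simpa using hδ.le) (by
        rw [abs_of_nonneg ht.1]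
        exact (ht.2.trans hh.2).trans hh₂δ) (z t) (Metric.mem_closedBall_self hδ.le)
      exact hmem'
    rw [hz0] at e1
    have e3 := hnum h ⟨hh0, hh.2.trans hh₂h₁⟩ x hx
    have hsum : ∑ k ∈ Finset.range m, h ^ k • c k (x.1, x.2) =
        ∑ k ∈ Finset.range m, h ^ k • d k x :=
      Finset.sum_congr rfl fun k hk => by rw [← hcoef x hx k (Finset.mem_range.1 hk)]
    rw [hsum] at e1
    calc _ = ‖(z h - ∑ k ∈ Finset.range m, h ^ k • d k x)
          + -(D (h, x) - ∑ k ∈ Finset.range m, h ^ k • d k x)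
          + -(stepValue tab (fun t => H h t x.1) 0 h x.2 Y - D (h, x))‖ := by congr 1; abel
      _ ≤ C₁ * h ^ m + C₂ * h ^ m + C₃ * h ^ m := by
        refine (norm_add_le _ _).trans (add_le_add ((norm_add_le _ _).trans (add_le_add e1 ?_)) ?_)
        · rw [norm_neg]
          exact e3
        · rw [norm_neg]
          exact hYD
      _ ≤ _ := by
        have : 0 ≤ κ * M * h ^ m := by positivity
        linarith [add_mul (κ * M) (C₁ + C₂ + C₃) (h ^ m), add_mul (C₁ + C₂) C₃ (h ^ m),
          add_mul C₁ C₂ (h ^ m)]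

end LocalError

section Hadamard

variable {E : Type} [NormedAddCommGroup E] [NormedSpace ℝ E] [CompleteSpace E]

omit [CompleteSpace E] in
theorem avg_eq_integral_unit (u : ℝ → E) : avg u = ∫ t in (0 : ℝ)..1, u (2 * Real.pi * t) := by
  have h := intervalIntegral.integral_comp_mul_left (a := 0) (b := 1) u
    (c := 2 * Real.pi) (by positivity)
  simp only [mul_zero, mul_one] at h
  rw [h, avg]

/-- Hadamard's lemma: the increment of a smooth map, with a smooth slope. -/
theorem exists_slope {f : ℝ → E → E} (hf : ContDiff ℝ ∞ (fun x : ℝ × E => f x.1 x.2)) :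
    ∃ B : ℝ × E × E → E →L[ℝ] E, ContDiff ℝ ∞ B ∧
      ∀ τ x ξ, f τ (x + ξ) - f τ x = B (τ, x, ξ) ξ := by
  set A : ℝ × E → E →L[ℝ] E := fun q => fderiv ℝ (fun y => f q.1 y) q.2 with hA
  have hAs : ContDiff ℝ ∞ A :=
    contDiffOn_univ.1 (contDiffOn_partial_fderiv isOpen_univ hf.contDiffOn)
  refine ⟨fun q => ∫ t in (0 : ℝ)..1, A (q.1, q.2.1 + t • q.2.2), ?_, fun τ x ξ => ?_⟩
  · rw [← contDiffOn_univ]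
    exact contDiffOn_integral_unit (u := fun r : ℝ × ℝ × E × E => A (r.2.1, r.2.2.1 + r.1 • r.2.2.2))
      isOpen_univ (hAs.comp (by fun_prop)).contDiffOn
  · have hfτ : ∀ y, HasFDerivAt (fun y => f τ y) (A (τ, y)) y := fun y =>
      ((hf.comp (by fun_prop : ContDiff ℝ ∞ fun y : E => (τ, y))).differentiable
        (by simp) y).hasFDerivAt
    have hline : Continuous fun t : ℝ => A (τ, x + t • ξ) := hAs.continuous.comp (by fun_prop)
    have hd : ∀ t ∈ uIcc (0 : ℝ) 1, HasDerivAt (fun t : ℝ => f τ (x + t • ξ))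
        (A (τ, x + t • ξ) ξ) t := fun t _ => by
      have h1 : HasDerivAt (fun t : ℝ => x + t • ξ) ξ t := by
        simpa using ((hasDerivAt_id t).smul_const ξ).const_add x
      exact (hfτ _).comp_hasDerivAt t h1
    have h2 := intervalIntegral.integral_eq_sub_of_hasDerivAt hd
      ((hline.clm_apply continuous_const).intervalIntegrable _ _)
    rw [ContinuousLinearMap.intervalIntegral_apply (hline.intervalIntegrable _ _), h2]
    simp

end Hadamard

section Phi

variable {E : Type} [NormedAddCommGroup E] [NormedSpace ℝ E] [FiniteDimensional ℝ E]
  {f : ℝ → E → E}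

/-- The derivative of `φ^{[k]}` in time, divided by `ε`, of the next high oscillation generator. -/
noncomputable def residual (f : ℝ → E → E) (k : ℕ) (q : ℝ × ℝ × E) : E :=
  f q.1 (phi f q.2.1 k q.1 q.2.2)
    - fderiv ℝ (phi f q.2.1 k q.1) q.2.2 (field f q.2.1 k q.2.2)

/-- On `O`, the change of variables `φ^{[k]}` is smooth and its averaged Jacobian is invertible. -/
structure PhiRegular (f : ℝ → E → E) (O : Set (ℝ × E)) (k : ℕ) : Prop where
  smooth : ContDiffOn ℝ ∞ (fun q : ℝ × ℝ × E => phi f q.2.1 k q.1 q.2.2) (univ ×ˢ O)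
  inv : ∀ x ∈ O, (avgJacobian (phi f x.1 k) x.2).IsInvertible

omit [FiniteDimensional ℝ E] in
theorem contDiffOn_fderiv_last {F : Type} [NormedAddCommGroup F] [NormedSpace ℝ F]
    {u : ℝ × ℝ × E → F} {s : Set (ℝ × ℝ × E)} (hs : IsOpen s) (hu : ContDiffOn ℝ ∞ u s) :
    ContDiffOn ℝ ∞ (fun q : ℝ × ℝ × E => fderiv ℝ (fun y => u (q.1, q.2.1, y)) q.2.2) s := by
  set e : (ℝ × ℝ) × E → ℝ × ℝ × E := fun r => (r.1.1, r.1.2, r.2) with he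
  have hec : ContDiff ℝ ∞ e := by fun_prop
  have h := contDiffOn_partial_fderiv (u := u ∘ e) (hs.preimage hec.continuous)
    (hu.comp hec.contDiffOn fun r hr => hr)
  exact h.comp (f := fun q : ℝ × ℝ × E => ((q.1, q.2.1), q.2.2)) (by fun_prop) fun q hq => hq

theorem contDiffOn_clm_inverse {X : Type} [NormedAddCommGroup X] [NormedSpace ℝ X]
    {A : X → E →L[ℝ] E} {s : Set X} (hA : ContDiffOn ℝ ∞ A s) (hinv : ∀ x ∈ s, (A x).IsInvertible) :
    ContDiffOn ℝ ∞ (fun x => (A x).inverse) s := by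
  have : CompleteSpace E := FiniteDimensional.complete ℝ E
  exact fun x hx => ((hinv x hx).contDiffAt_map_inverse).comp_contDiffWithinAt x (hA x hx)

namespace PhiRegular

variable {O : Set (ℝ × E)} {k : ℕ}

omit [FiniteDimensional ℝ E] in
theorem contDiffOn_fderiv (hO : IsOpen O) (h : PhiRegular f O k) :
    ContDiffOn ℝ ∞ (fun q : ℝ × ℝ × E => fderiv ℝ (phi f q.2.1 k q.1) q.2.2) (univ ×ˢ O) :=
  contDiffOn_fderiv_last (isOpen_univ.prod hO) h.smooth

omit [FiniteDimensional ℝ E] in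
theorem contDiffOn_avgJacobian (hO : IsOpen O)
    (h : ContDiffOn ℝ ∞ (fun q : ℝ × ℝ × E => phi f q.2.1 k q.1 q.2.2) (univ ×ˢ O)) :
    ContDiffOn ℝ ∞ (fun x : ℝ × E => avgJacobian (phi f x.1 k) x.2) O :=
  contDiffOn_partial_fderiv hO (contDiffOn_avg hO h)

omit [FiniteDimensional ℝ E] in
theorem contDiffOn_comp (hf : ContDiff ℝ ∞ (fun x : ℝ × E => f x.1 x.2)) (h : PhiRegular f O k) :
    ContDiffOn ℝ ∞ (fun q : ℝ × ℝ × E => f q.1 (phi f q.2.1 k q.1 q.2.2)) (univ ×ˢ O) :=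
  hf.comp_contDiffOn (contDiffOn_fst.prodMk h.smooth)

theorem contDiffOn_field (hf : ContDiff ℝ ∞ (fun x : ℝ × E => f x.1 x.2)) (hO : IsOpen O)
    (h : PhiRegular f O k) : ContDiffOn ℝ ∞ (fun x : ℝ × E => field f x.1 k x.2) O :=
  (contDiffOn_clm_inverse (contDiffOn_avgJacobian hO h.smooth) h.inv).clm_apply
    (contDiffOn_avg hO (h.contDiffOn_comp hf))

theorem contDiffOn_residual (hf : ContDiff ℝ ∞ (fun x : ℝ × E => f x.1 x.2)) (hO : IsOpen O)
    (h : PhiRegular f O k) : ContDiffOn ℝ ∞ (residual f k) (univ ×ˢ O) :=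
  (h.contDiffOn_comp hf).sub ((h.contDiffOn_fderiv hO).clm_apply
    ((h.contDiffOn_field hf hO).comp contDiffOn_snd fun _ hq => hq.2))

omit [FiniteDimensional ℝ E] in
theorem phi_succ (f : ℝ → E → E) (ε : ℝ) (k : ℕ) (τ : ℝ) (y : E) :
    phi f ε (k + 1) τ y = y + ε • ∫ σ in (0 : ℝ)..τ, residual f k (σ, ε, y) := rfl

theorem contDiffOn_phi_succ (hf : ContDiff ℝ ∞ (fun x : ℝ × E => f x.1 x.2)) (hO : IsOpen O)
    (h : PhiRegular f O k) :
    ContDiffOn ℝ ∞ (fun q : ℝ × ℝ × E => phi f q.2.1 (k + 1) q.1 q.2.2) (univ ×ˢ O) := by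
  have h1 := contDiffOn_integral_upper hO (h.contDiffOn_residual hf hO)
  exact ContDiffOn.add (by fun_prop) (ContDiffOn.smul (by fun_prop) h1)

theorem continuous_residual (hf : ContDiff ℝ ∞ (fun x : ℝ × E => f x.1 x.2)) (hO : IsOpen O)
    (h : PhiRegular f O k) {x : ℝ × E} (hx : x ∈ O) :
    Continuous fun τ => residual f k (τ, x) :=
  (h.contDiffOn_residual hf hO).continuousOn.comp_continuous (by fun_prop)
    fun _ => ⟨mem_univ _, hx⟩

theorem hasDerivAt_phi_succ (hf : ContDiff ℝ ∞ (fun x : ℝ × E => f x.1 x.2)) (hO : IsOpen O)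
    (h : PhiRegular f O k) {x : ℝ × E} (hx : x ∈ O) (τ : ℝ) :
    HasDerivAt (fun τ => phi f x.1 (k + 1) τ x.2) (x.1 • residual f k (τ, x)) τ := by
  have : CompleteSpace E := FiniteDimensional.complete ℝ E
  have hc := h.continuous_residual hf hO hx
  exact ((intervalIntegral.integral_hasDerivAt_right (hc.intervalIntegrable _ _)
    (hc.stronglyMeasurableAtFilter _ _) hc.continuousAt).const_smul x.1).const_add x.2

theorem avgJacobian_eq (hO : IsOpen O) (h : PhiRegular f O k) {x : ℝ × E} (hx : x ∈ O) :
    avgJacobian (phi f x.1 k) x.2 = avg fun τ => fderiv ℝ (phi f x.1 k τ) x.2 := by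
  have : CompleteSpace E := FiniteDimensional.complete ℝ E
  have ho : IsOpen {y | (x.1, y) ∈ O} := hO.preimage (by fun_prop)
  have hu : ContDiffOn ℝ ∞ (fun r : ℝ × E => phi f x.1 k (2 * Real.pi * r.1) r.2)
      (univ ×ˢ {y | (x.1, y) ∈ O}) :=
    h.smooth.comp (f := fun r : ℝ × E => (2 * Real.pi * r.1, x.1, r.2)) (by fun_prop)
      fun r hr => ⟨mem_univ _, hr.2⟩
  rw [avg_eq_integral_unit]
  simp only [avgJacobian, avg_eq_integral_unit]
  rw [(hasFDerivAt_integral_unit ho hu hx).fderiv]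
  refine intervalIntegral.integral_congr fun t _ => ?_
  have h2 := ((hu.contDiffAt ((isOpen_univ.prod ho).mem_nhds
    (show (t, x.2) ∈ univ ×ˢ {y | (x.1, y) ∈ O} from ⟨mem_univ _, hx⟩))).differentiableAt
    (by simp)).hasFDerivAt
  exact (h2.comp (f := fun y => (t, y)) x.2 (hasFDerivAt_prodMk_right t x.2)).fderiv.symm

theorem integral_residual (hf : ContDiff ℝ ∞ (fun x : ℝ × E => f x.1 x.2)) (hO : IsOpen O)
    (h : PhiRegular f O k) {x : ℝ × E} (hx : x ∈ O) :
    ∫ τ in (0 : ℝ)..2 * Real.pi, residual f k (τ, x) = 0 := by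
  have : CompleteSpace E := FiniteDimensional.complete ℝ E
  have hc1 : Continuous fun τ => f τ (phi f x.1 k τ x.2) :=
    (h.contDiffOn_comp hf).continuousOn.comp_continuous (f := fun τ : ℝ => (τ, x)) (by fun_prop)
      fun _ => ⟨mem_univ _, hx⟩
  have hc2 : Continuous fun τ => fderiv ℝ (phi f x.1 k τ) x.2 :=
    (h.contDiffOn_fderiv hO).continuousOn.comp_continuous (f := fun τ : ℝ => (τ, x)) (by fun_prop)
      fun _ => ⟨mem_univ _, hx⟩
  have hJ : avgJacobian (phi f x.1 k) x.2 (field f x.1 k x.2) =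
      avg (fun τ => f τ (phi f x.1 k τ x.2)) := (h.inv x hx).self_apply_inverse _
  rw [h.avgJacobian_eq hO hx, avg, avg, smul_apply,
    ContinuousLinearMap.intervalIntegral_apply (hc2.intervalIntegrable _ _)] at hJ
  have hpi : (2 * Real.pi)⁻¹ ≠ 0 := by positivity
  have hJ' := smul_right_injective E hpi hJ
  simp only [residual]
  rw [intervalIntegral.integral_sub (hc1.intervalIntegrable _ _)
    ((hc2.clm_apply continuous_const).intervalIntegrable _ _), hJ', sub_self]

end PhiRegular

/-- The changes of variables `φ^{[k]}`, `k ≤ p`, are smooth on a common neighbourhood. -/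
theorem exists_phiRegular (hf : ContDiff ℝ ∞ (fun x : ℝ × E => f x.1 x.2)) {K : Set (ℝ × E)} (p : ℕ)
    (hinv : ∀ k ≤ p, ∀ x ∈ K, (avgJacobian (phi f x.1 k) x.2).IsInvertible) :
    ∃ O : Set (ℝ × E), IsOpen O ∧ K ⊆ O ∧ ∀ k ≤ p, PhiRegular f O k := by
  have : CompleteSpace E := FiniteDimensional.complete ℝ E
  have shrink : ∀ k (O : Set (ℝ × E)), IsOpen O → K ⊆ O →
      (∀ x ∈ K, (avgJacobian (phi f x.1 k) x.2).IsInvertible) →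
      ContDiffOn ℝ ∞ (fun q : ℝ × ℝ × E => phi f q.2.1 k q.1 q.2.2) (univ ×ˢ O) →
      ∃ O' ⊆ O, IsOpen O' ∧ K ⊆ O' ∧ PhiRegular f O' k := by
    intro k O hO hKO hk hs
    refine ⟨O ∩ (fun x : ℝ × E => avgJacobian (phi f x.1 k) x.2) ⁻¹'
        range ((↑) : (E ≃L[ℝ] E) → E →L[ℝ] E), inter_subset_left,
      (PhiRegular.contDiffOn_avgJacobian hO hs).continuousOn.isOpen_inter_preimage hO
        ContinuousLinearEquiv.isOpen, fun x hx => ⟨hKO hx, ?_⟩, ?_, ?_⟩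
    · obtain ⟨e, he⟩ := hk x hx
      exact ⟨e, he⟩
    · exact hs.mono (prod_mono_right inter_subset_left)
    · rintro x ⟨-, e, he⟩
      exact ⟨e, he⟩
  induction p with
  | zero =>
    obtain ⟨O, -, hO, hKO, h⟩ := shrink 0 univ isOpen_univ (subset_univ _) (hinv 0 le_rfl) (by
      show ContDiffOn ℝ ∞ (fun q : ℝ × ℝ × E => q.2.2) _
      fun_prop)
    exact ⟨O, hO, hKO, fun k hk => by rwa [Nat.le_zero.1 hk]⟩
  | succ p ih =>
    obtain ⟨O, hO, hKO, h⟩ := ih fun k hk => hinv k (hk.trans (Nat.le_succ p))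
    obtain ⟨O', hOO', hO', hKO', h'⟩ := shrink (p + 1) O hO hKO (hinv _ le_rfl)
      ((h p le_rfl).contDiffOn_phi_succ hf hO)
    refine ⟨O', hO', hKO', fun k hk => ?_⟩
    rcases Nat.le_succ_iff.1 hk with hk | rfl
    · exact ⟨(h k hk).smooth.mono (prod_mono_right hOO'), fun x hx => (h k hk).inv x (hOO' hx)⟩
    · exact h'

end Phi

section Phi

variable {E : Type} [NormedAddCommGroup E] [NormedSpace ℝ E] [FiniteDimensional ℝ E]
  {f : ℝ → E → E} {O : Set (ℝ × E)}

omit [FiniteDimensional ℝ E] in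
theorem fderiv_phi_periodic (hO : IsOpen O) {k : ℕ}
    (h : ∀ x ∈ O, ∀ τ, phi f x.1 k (τ + 2 * Real.pi) x.2 = phi f x.1 k τ x.2)
    {x : ℝ × E} (hx : x ∈ O) (τ : ℝ) :
    fderiv ℝ (phi f x.1 k (τ + 2 * Real.pi)) x.2 = fderiv ℝ (phi f x.1 k τ) x.2 := by
  refine Filter.EventuallyEq.fderiv_eq ?_
  have ho : IsOpen {y | (x.1, y) ∈ O} := hO.preimage (by fun_prop)
  filter_upwards [ho.mem_nhds (show x.2 ∈ {y | (x.1, y) ∈ O} from hx)] with y hy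
  exact h (x.1, y) hy τ

theorem phi_periodic (hf : ContDiff ℝ ∞ (fun x : ℝ × E => f x.1 x.2))
    (hper : ∀ τ y, f (τ + 2 * Real.pi) y = f τ y) (hO : IsOpen O) (p : ℕ)
    (h : ∀ k < p, PhiRegular f O k) :
    ∀ x ∈ O, ∀ τ, phi f x.1 p (τ + 2 * Real.pi) x.2 = phi f x.1 p τ x.2 := by
  induction p with
  | zero => exact fun _ _ _ => rfl
  | succ k ih =>
    have ihk := ih fun j hj => h j (hj.trans (Nat.lt_succ_self k))
    intro x hx τ
    have hk := h k (Nat.lt_succ_self k)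
    have hc := hk.continuous_residual hf hO hx
    have hpr : Function.Periodic (fun σ => residual f k (σ, x)) (2 * Real.pi) := fun σ => by
      simp only [residual]
      rw [ihk x hx, fderiv_phi_periodic hO ihk hx, hper]
    have h0 : ∫ σ in (0 : ℝ)..(τ + 2 * Real.pi), residual f k (σ, x) =
        ∫ σ in (0 : ℝ)..τ, residual f k (σ, x) := by
      rw [← intervalIntegral.integral_add_adjacent_intervals (hc.intervalIntegrable 0 τ)
        (hc.intervalIntegrable τ _), hpr.intervalIntegral_add_eq τ 0, zero_add,
        hk.integral_residual hf hO hx, add_zero]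
    rw [PhiRegular.phi_succ, PhiRegular.phi_succ, h0]

/-- If `φ^{[k+1]} - φ^{[k]}` is divisible by `ε ^ m`, then so is the difference of the residuals. -/
theorem exists_residual_sub (hf : ContDiff ℝ ∞ (fun x : ℝ × E => f x.1 x.2)) (hO : IsOpen O)
    {k m : ℕ} (h : PhiRegular f O k) (h' : PhiRegular f O (k + 1)) {ψ : ℝ × ℝ × E → E}
    (hψ : ContDiffOn ℝ ∞ ψ (univ ×ˢ O))
    (hφ : ∀ q ∈ univ ×ˢ O, phi f q.2.1 (k + 1) q.1 q.2.2 =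
      phi f q.2.1 k q.1 q.2.2 + q.2.1 ^ m • ψ q) :
    ∃ ρ : ℝ × ℝ × E → E, ContDiffOn ℝ ∞ ρ (univ ×ˢ O) ∧ ∀ q ∈ univ ×ˢ O,
      residual f (k + 1) q = residual f k q + q.2.1 ^ m • ρ q := by
  have : CompleteSpace E := FiniteDimensional.complete ℝ E
  have ho : IsOpen ((univ : Set ℝ) ×ˢ O) := isOpen_univ.prod hO
  obtain ⟨B, hB, hfB⟩ := exists_slope hf
  -- the difference of `f(φ)`
  set α : ℝ × ℝ × E → E := fun q =>
    B (q.1, phi f q.2.1 k q.1 q.2.2, q.2.1 ^ m • ψ q) (ψ q) with hα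
  have hαs : ContDiffOn ℝ ∞ α (univ ×ˢ O) := by
    refine ContDiffOn.clm_apply (hB.comp_contDiffOn (contDiffOn_fst.prodMk (h.smooth.prodMk
      (ContDiffOn.smul (by fun_prop) hψ)))) hψ
  have hfα : ∀ q ∈ univ ×ˢ O, f q.1 (phi f q.2.1 (k + 1) q.1 q.2.2) =
      f q.1 (phi f q.2.1 k q.1 q.2.2) + q.2.1 ^ m • α q := fun q hq => by
    rw [hφ q hq, hα, ← sub_eq_iff_eq_add', hfB, map_smul]
  -- the difference of the derivatives
  set Dψ : ℝ × ℝ × E → E →L[ℝ] E := fun q => fderiv ℝ (fun y => ψ (q.1, q.2.1, y)) q.2.2 with hDψ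
  have hDψs : ContDiffOn ℝ ∞ Dψ (univ ×ˢ O) := contDiffOn_fderiv_last ho hψ
  have hDφ : ∀ q ∈ univ ×ˢ O, fderiv ℝ (phi f q.2.1 (k + 1) q.1) q.2.2 =
      fderiv ℝ (phi f q.2.1 k q.1) q.2.2 + q.2.1 ^ m • Dψ q := fun q hq => by
    have hq' : {y | (q.1, q.2.1, y) ∈ (univ : Set ℝ) ×ˢ O} ∈ 𝓝 q.2.2 :=
      (ho.preimage (by fun_prop : Continuous fun y : E => (q.1, q.2.1, y))).mem_nhds hq
    have hev : phi f q.2.1 (k + 1) q.1 =ᶠ[𝓝 q.2.2]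
        fun y => phi f q.2.1 k q.1 y + q.2.1 ^ m • ψ (q.1, q.2.1, y) := by
      filter_upwards [hq'] with y hy using hφ (q.1, q.2.1, y) hy
    have hinc : ∀ {u : ℝ × ℝ × E → E}, ContDiffOn ℝ ∞ u (univ ×ˢ O) →
        DifferentiableAt ℝ (fun y => u (q.1, q.2.1, y)) q.2.2 := fun {u} hu =>
      ((hu.contDiffAt (ho.mem_nhds hq)).comp q.2.2 (f := fun y : E => (q.1, q.2.1, y))
        (by fun_prop)).differentiableAt (by simp)
    rw [hev.fderiv_eq]
    exact ((hinc h.smooth).hasFDerivAt.add ((hinc hψ).hasFDerivAt.const_smul _)).fderiv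
  -- the difference of the averaged Jacobians
  set Jψ : ℝ × E → E →L[ℝ] E := fun x => avg fun τ => Dψ (τ, x) with hJψ
  have hJψs : ContDiffOn ℝ ∞ Jψ O := contDiffOn_avg hO hDψs
  have hline : ∀ {F : Type} [NormedAddCommGroup F] [NormedSpace ℝ F] {u : ℝ × ℝ × E → F}
      {x : ℝ × E}, ContDiffOn ℝ ∞ u (univ ×ˢ O) → x ∈ O → ∀ a b,
      IntervalIntegrable (fun τ => u (τ, x)) MeasureTheory.volume a b :=
    fun hu hx a b => (hu.continuousOn.comp_continuous (by fun_prop)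
      fun _ => ⟨mem_univ _, hx⟩).intervalIntegrable a b
  have havg : ∀ {F : Type} [NormedAddCommGroup F] [NormedSpace ℝ F] {u v u' : ℝ × ℝ × E → F}
      {x : ℝ × E}, ContDiffOn ℝ ∞ u (univ ×ˢ O) → ContDiffOn ℝ ∞ v (univ ×ˢ O) → x ∈ O →
      (∀ q ∈ univ ×ˢ O, u' q = u q + q.2.1 ^ m • v q) →
      avg (fun τ => u' (τ, x)) = avg (fun τ => u (τ, x)) + x.1 ^ m • avg (fun τ => v (τ, x)) := by
    intro F _ _ u v u' x hu hv hx huv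
    have : (fun τ => u' (τ, x)) = fun τ => u (τ, x) + x.1 ^ m • v (τ, x) :=
      funext fun τ => huv (τ, x) ⟨mem_univ _, hx⟩
    have hvs : IntervalIntegrable (fun τ => x.1 ^ m • v (τ, x)) MeasureTheory.volume 0
      (2 * Real.pi) := (hline hv hx _ _).smul _
    rw [this, avg, avg, avg, intervalIntegral.integral_add (hline hu hx _ _) hvs,
      intervalIntegral.integral_smul, smul_add, smul_comm]
  have hJ : ∀ x ∈ O, avgJacobian (phi f x.1 (k + 1)) x.2 =
      avgJacobian (phi f x.1 k) x.2 + x.1 ^ m • Jψ x := fun x hx => by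
    rw [h'.avgJacobian_eq hO hx, h.avgJacobian_eq hO hx]
    exact havg (h.contDiffOn_fderiv hO) hDψs hx hDφ
  -- the difference of the averaged fields
  set Fψ : ℝ × E → E := fun x => (avgJacobian (phi f x.1 (k + 1)) x.2).inverse
    (avg (fun τ => α (τ, x)) - Jψ x (field f x.1 k x.2)) with hFψ
  have hFψs : ContDiffOn ℝ ∞ Fψ O :=
    (contDiffOn_clm_inverse (PhiRegular.contDiffOn_avgJacobian hO h'.smooth) h'.inv).clm_apply
      ((contDiffOn_avg hO hαs).sub (hJψs.clm_apply (h.contDiffOn_field hf hO)))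
  have hF : ∀ x ∈ O, field f x.1 (k + 1) x.2 = field f x.1 k x.2 + x.1 ^ m • Fψ x := fun x hx => by
    have hi := h'.inv x hx
    refine hi.injective ?_
    have h1 : avgJacobian (phi f x.1 (k + 1)) x.2 (field f x.1 (k + 1) x.2) =
        avg (fun τ => f τ (phi f x.1 (k + 1) τ x.2)) := hi.self_apply_inverse _
    have h2 : avgJacobian (phi f x.1 k) x.2 (field f x.1 k x.2) =
        avg (fun τ => f τ (phi f x.1 k τ x.2)) := (h.inv x hx).self_apply_inverse _
    have h3 := havg (h.contDiffOn_comp hf) hαs hx hfα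
    rw [h1, map_add, map_smul, hFψ, hi.self_apply_inverse, h3, ← h2, hJ x hx,
      add_apply, smul_apply, smul_sub]
    abel
  refine ⟨fun q => α q - (fderiv ℝ (phi f q.2.1 (k + 1) q.1) q.2.2 (Fψ q.2)
    + Dψ q (field f q.2.1 k q.2.2)), hαs.sub (ContDiffOn.add ?_ ?_), fun q hq => ?_⟩
  · exact (h'.contDiffOn_fderiv hO).clm_apply (hFψs.comp contDiffOn_snd fun _ hq => hq.2)
  · exact hDψs.clm_apply ((h.contDiffOn_field hf hO).comp contDiffOn_snd fun _ hq => hq.2)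
  · rw [residual, residual, hfα q hq, hF q.2 hq.2, map_add, map_smul]
    nth_rewrite 1 [hDφ q hq]
    rw [add_apply, smul_apply, smul_sub, smul_add]
    abel

theorem exists_phi_sub (hf : ContDiff ℝ ∞ (fun x : ℝ × E => f x.1 x.2)) (hO : IsOpen O) (k : ℕ)
    (h : ∀ j ≤ k, PhiRegular f O j) :
    ∃ ψ : ℝ × ℝ × E → E, ContDiffOn ℝ ∞ ψ (univ ×ˢ O) ∧ ∀ q ∈ univ ×ˢ O,
      phi f q.2.1 (k + 1) q.1 q.2.2 = phi f q.2.1 k q.1 q.2.2 + q.2.1 ^ (k + 1) • ψ q := by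
  induction k with
  | zero =>
    refine ⟨_, contDiffOn_integral_upper hO ((h 0 le_rfl).contDiffOn_residual hf hO), fun q hq => ?_⟩
    rw [PhiRegular.phi_succ, pow_one]
    rfl
  | succ k ih =>
    obtain ⟨ψ, hψ, hφ⟩ := ih fun j hj => h j (hj.trans (Nat.le_succ k))
    have hk := h k (Nat.le_succ k)
    obtain ⟨ρ, hρ, hr⟩ := exists_residual_sub hf hO hk (h (k + 1) le_rfl) hψ hφ
    refine ⟨_, contDiffOn_integral_upper hO hρ, fun q hq => ?_⟩
    have hi1 := (hk.continuous_residual hf hO hq.2).intervalIntegrable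
      (μ := MeasureTheory.volume) 0 q.1
    have hi2 : IntervalIntegrable (fun σ => ρ (σ, q.2)) MeasureTheory.volume 0 q.1 :=
      (hρ.continuousOn.comp_continuous (f := fun σ : ℝ => (σ, q.2)) (by fun_prop)
        fun _ => ⟨mem_univ _, hq.2⟩).intervalIntegrable _ _
    have hi3 : IntervalIntegrable (fun σ => q.2.1 ^ (k + 1) • ρ (σ, q.2)) MeasureTheory.volume 0 q.1 :=
      hi2.smul _
    have hint : ∫ σ in (0 : ℝ)..q.1, residual f (k + 1) (σ, q.2) =
        (∫ σ in (0 : ℝ)..q.1, residual f k (σ, q.2)) +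
          q.2.1 ^ (k + 1) • ∫ σ in (0 : ℝ)..q.1, ρ (σ, q.2) := by
      rw [← intervalIntegral.integral_smul, ← intervalIntegral.integral_add hi1 hi3]
      exact intervalIntegral.integral_congr fun σ _ => hr (σ, q.2) ⟨mem_univ _, hq.2⟩
    rw [PhiRegular.phi_succ, PhiRegular.phi_succ]
    show q.2.2 + q.2.1 • (∫ σ in (0 : ℝ)..q.1, residual f (k + 1) (σ, q.2)) =
      q.2.2 + q.2.1 • (∫ σ in (0 : ℝ)..q.1, residual f k (σ, q.2)) +
        q.2.1 ^ (k + 1 + 1) • ∫ σ in (0 : ℝ)..q.1, ρ (σ, q.2)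
    rw [hint, smul_add, smul_smul, ← pow_succ', add_assoc q.2.2]

/-- The micro field: its dependence on `w`, and a remainder which is divisible by `ε ^ p`. -/
theorem exists_micro_remainder (hf : ContDiff ℝ ∞ (fun x : ℝ × E => f x.1 x.2)) (hO : IsOpen O)
    {p : ℕ} (hp : 1 ≤ p) (h : ∀ j ≤ p, PhiRegular f O j) :
    ∃ ρ : ℝ × ℝ × E → E, ContDiffOn ℝ ∞ ρ (univ ×ˢ O) ∧ ∀ x ∈ O, x.1 ≠ 0 → ∀ τ w,
      g f p τ w x.2 x.1 = f τ (phi f x.1 p τ x.2 + w) - f τ (phi f x.1 p τ x.2)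
        + x.1 ^ p • ρ (τ, x) := by
  obtain ⟨k, rfl⟩ : ∃ k, p = k + 1 := ⟨p - 1, by omega⟩
  have hk := h k (Nat.le_succ k)
  obtain ⟨ψ, hψ, hφ⟩ := exists_phi_sub hf hO k fun j hj => h j (hj.trans (Nat.le_succ k))
  obtain ⟨ρ, hρ, hr⟩ := exists_residual_sub hf hO hk (h (k + 1) le_rfl) hψ hφ
  refine ⟨ρ, hρ, fun x hx hε τ w => ?_⟩
  have h1 := hr (τ, x) ⟨mem_univ _, hx⟩
  have h2 : x.1⁻¹ • deriv (fun σ => phi f x.1 (k + 1) σ x.2) τ = residual f k (τ, x) := by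
    rw [(hk.hasDerivAt_phi_succ hf hO hx τ).deriv, smul_smul, inv_mul_cancel₀ hε, one_smul]
  have h3 : x.1 ^ (k + 1) • ρ (τ, x) = residual f (k + 1) (τ, x) - residual f k (τ, x) := by
    rw [h1]
    exact (add_sub_cancel_left _ _).symm
  rw [g, micro, h2, h3]
  simp only [residual]
  abel

theorem micro_periodic (hf : ContDiff ℝ ∞ (fun x : ℝ × E => f x.1 x.2))
    (hper : ∀ τ y, f (τ + 2 * Real.pi) y = f τ y) (hO : IsOpen O) {p : ℕ}
    (h : ∀ j ≤ p, PhiRegular f O j) {x : ℝ × E} (hx : x ∈ O) (τ : ℝ) (w : E) :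
    g f p (τ + 2 * Real.pi) w x.2 x.1 = g f p τ w x.2 x.1 := by
  have hφ := phi_periodic hf hper hO p fun k hk => h k hk.le
  rw [g, g, micro, micro, fderiv_phi_periodic hO hφ hx, hφ x hx, hper,
    ← deriv_comp_add_const (fun σ => phi f x.1 p σ x.2) (2 * Real.pi) τ]
  simp only [hφ x hx]

end Phi

section Comparison

variable {V : Type} [NormedAddCommGroup V] [NormedSpace ℝ V] {s : ℕ}

/-- Stability of a Runge-Kutta step with respect to the initial value and the field. -/
theorem step_compare (tab : ButcherTableau s) {h L δ : ℝ} {y y' : V} {Y Y' k k' : Fin s → V}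
    (hh : 0 ≤ h) (hL : 0 ≤ L) (hδ : 0 ≤ δ) (hhL : h * tab.bound * L ≤ 1 / 2)
    (hY : ∀ i, Y i = y + h • ∑ j, tab.A i j • k j)
    (hY' : ∀ i, Y' i = y' + h • ∑ j, tab.A i j • k' j)
    (hk : ∀ j, ‖k j - k' j‖ ≤ L * ‖Y j - Y' j‖ + δ) :
    (∀ i, ‖Y i - Y' i‖ ≤ 2 * (‖y - y'‖ + h * tab.bound * δ)) ∧
    ‖(y + h • ∑ j, tab.b j • k j) - (y' + h • ∑ j, tab.b j • k' j)‖ ≤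
      (1 + 2 * tab.bound * L * h) * ‖y - y'‖ + h * (2 * tab.bound * δ) := by
  have hκ := tab.bound_pos
  set κ := tab.bound with hκd
  set D := ‖Y - Y'‖ with hD
  have hD0 : 0 ≤ D := norm_nonneg _
  have hkD : ∀ j, ‖k j - k' j‖ ≤ L * D + δ := fun j => (hk j).trans
    (by have : ‖Y j - Y' j‖ ≤ D := norm_le_pi_norm (Y - Y') j
        gcongr)
  have hsum : ∀ c : Fin s → ℝ, ∑ j, |c j| ≤ κ →
      ‖(y + h • ∑ j, c j • k j) - (y' + h • ∑ j, c j • k' j)‖ ≤ ‖y - y'‖ + h * (κ * (L * D + δ)) := by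
    intro c hc
    have : (y + h • ∑ j, c j • k j) - (y' + h • ∑ j, c j • k' j) =
        (y - y') + h • ∑ j, c j • (k j - k' j) := by
      simp only [smul_sub, Finset.sum_sub_distrib]
      abel
    rw [this]
    refine (norm_add_le _ _).trans (add_le_add le_rfl ?_)
    rw [norm_smul, Real.norm_of_nonneg hh]
    exact mul_le_mul_of_nonneg_left (norm_weighted_sum_le hc (by positivity) hkD) hh
  have hDle : D ≤ ‖y - y'‖ + h * (κ * (L * D + δ)) := by
    refine (pi_norm_le_iff_of_nonneg (by positivity)).2 fun i => ?_
    rw [Pi.sub_apply, hY, hY']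
    exact hsum _ (tab.sum_abs_A_le i)
  have hhD : h * κ * L * D ≤ 1 / 2 * D := mul_le_mul_of_nonneg_right hhL hD0
  have hD2 : D ≤ 2 * (‖y - y'‖ + h * κ * δ) := by
    nlinarith [hDle, hhD]
  refine ⟨fun i => (norm_le_pi_norm (Y - Y') i).trans hD2, (hsum _ tab.sum_abs_b_le).trans ?_⟩
  have h1 : h * κ * L * D ≤ h * κ * L * (2 * (‖y - y'‖ + h * κ * δ)) :=
    mul_le_mul_of_nonneg_left hD2 (by positivity)
  have h2 : h * κ * L * (2 * (h * κ * δ)) ≤ 1 / 2 * (2 * (h * κ * δ)) :=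
    mul_le_mul_of_nonneg_right hhL (by positivity)
  nlinarith [h1, h2]

/-- The discrete Gronwall inequality, in the form used for one-step methods. -/
theorem discrete_gronwall_step {e : ℕ → ℝ} {lam h c T : ℝ} {N : ℕ} (hlam : 0 < lam) (hh : 0 ≤ h)
    (hc : 0 ≤ c) (hT : N * h ≤ T) (h0 : e 0 ≤ 0)
    (he : ∀ n < N, e (n + 1) ≤ (1 + lam * h) * e n + h * c) :
    ∀ n ≤ N, e n ≤ (Real.exp (lam * T) - 1) / lam * c := by
  have key : ∀ n ≤ N, e n ≤ ((1 + lam * h) ^ n - 1) / lam * c := by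
    intro n
    induction n with
    | zero => intro _; simpa using h0
    | succ n ih =>
      intro hn
      refine (he n hn).trans ?_
      have h1 := mul_le_mul_of_nonneg_left (ih (Nat.le_of_succ_le hn))
        (by positivity : 0 ≤ 1 + lam * h)
      have h2 : (1 + lam * h) * (((1 + lam * h) ^ n - 1) / lam * c) + h * c =
          ((1 + lam * h) ^ (n + 1) - 1) / lam * c := by
        field_simp
        ring
      linarith
  intro n hn
  refine (key n hn).trans (mul_le_mul_of_nonneg_right (div_le_div_of_nonneg_right
    (sub_le_sub_right ?_ 1) hlam.le) hc)
  have h1 : 1 + lam * h ≤ Real.exp (lam * h) := by linarith [Real.add_one_le_exp (lam * h)]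
  calc (1 + lam * h) ^ n ≤ Real.exp (lam * h) ^ n := by gcongr
    _ = Real.exp (n * (lam * h)) := (Real.exp_nat_mul _ _).symm
    _ ≤ Real.exp (lam * T) := by
      refine Real.exp_le_exp.2 ?_
      have : (n : ℝ) * h ≤ N * h := by gcongr
      nlinarith [mul_le_mul_of_nonneg_left (this.trans hT) hlam.le]

theorem IsSolutionOn.shift {G : ℝ → V → V} {T : ℝ} {z : ℝ → V} (hz : IsSolutionOn G 0 T z)
    {t h : ℝ} (ht : 0 ≤ t) (hth : t + h ≤ T) :
    IsSolutionOn (fun σ => G (t + σ)) 0 h fun σ => z (t + σ) := by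
  intro σ hσ
  have h1 := hz (t + σ) ⟨add_nonneg ht hσ.1, (add_le_add_right hσ.2 t).trans hth⟩
  have h2 : HasDerivWithinAt (fun σ : ℝ => t + σ) 1 (Icc 0 h) σ :=
    ((hasDerivAt_id σ).const_add t).hasDerivWithinAt
  have := h1.scomp σ h2 fun σ' hσ' => ⟨add_nonneg ht hσ'.1, (add_le_add_right hσ'.2 t).trans hth⟩
  simpa [Function.comp_def] using this

end Comparison

section Macro

variable {E : Type} [NormedAddCommGroup E] [NormedSpace ℝ E] [FiniteDimensional ℝ E] {s : ℕ}

/-- Global error of the macro part: the numerical solution for a field close to the truncated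
modified field, compared with the exact solution. -/
theorem macroscopic_error (tab : ButcherTableau s) {O K : Set (ℝ × E)} (hO : IsOpen O) (hK : IsCompact K)
    (hKO : K ⊆ O) {F : ℝ × ℝ × E → E} (hF : ContDiffOn ℝ ∞ F (univ ×ˢ O)) (m : ℕ)
    (hloc : ∀ x ∈ K, ∀ (r : ℝ) (z : ℝ → E), 0 < r → z 0 = x.2 →
      IsSolutionOn (fun _ y => F (0, x.1, y)) 0 r z →
      LocalErrorO tab (fun h _ y => F (h, x.1, y)) 0 z (m + 1)) (T : ℝ) :
    ∃ lam > (0 : ℝ), ∃ Cbar > (0 : ℝ), ∃ h₀ > (0 : ℝ), ∀ (N : ℕ) (h : ℝ), 0 < h → h ≤ h₀ →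
      N * h = T → ∀ (ε : ℝ) (v : ℝ → E), IsSolutionOn (fun _ y => F (0, ε, y)) 0 T v →
      (∀ t ∈ Icc 0 T, (ε, v t) ∈ K) → ∀ (Fθ : E → E) (δ : ℝ), 0 ≤ δ →
      (∀ y, (ε, y) ∈ K → ‖F (h, ε, y) - Fθ y‖ ≤ δ) → ∀ vθ : ℕ → E, vθ 0 = v 0 →
      (∀ n < N, ∃ Y : Fin s → E, (∀ i, (ε, Y i) ∈ K) ∧ IsStages tab (fun _ => Fθ) (n * h) h (vθ n) Y ∧
        vθ (n + 1) = stepValue tab (fun _ => Fθ) (n * h) h (vθ n) Y) →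
      ∀ n ≤ N, ‖v (n * h) - vθ n‖ ≤
        (Real.exp (lam * T) - 1) / lam * (Cbar * h ^ m + 2 * tab.bound * δ) := by
  have : ProperSpace E := FiniteDimensional.proper ℝ E
  have hκ := tab.bound_pos
  obtain ⟨C, hC, h₁, hh₁, hue⟩ := uniform_local_error tab (P := ℝ) (V := E)
    (H := fun h _ ε y => F (h, ε, y))
    (O := (fun q : ℝ × ℝ × ℝ × E => q.2.2) ⁻¹' O) (hO.preimage (by fun_prop))
    (hF.comp (f := fun q : ℝ × ℝ × ℝ × E => (q.1, q.2.2.1, q.2.2.2)) (by fun_prop)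
      fun q hq => ⟨mem_univ _, hq⟩) hK (fun x hx => hKO hx) (m + 1) hloc
  obtain ⟨ρ, hρ, hρO⟩ := hK.exists_cthickening_subset_open hO hKO
  obtain ⟨L, hL, hlip⟩ := exists_lipschitz_of_compact (isOpen_univ.prod hO) hF
    ((isCompact_Icc (a := (0 : ℝ)) (b := h₁)).prod hK.cthickening)
    (prod_mono (subset_univ _) hρO)
  refine ⟨2 * tab.bound * L, by positivity, C, hC,
    min h₁ (min (ρ / C) (1 / 2 / (tab.bound * L))), by positivity, ?_⟩
  intro N h hh hh₀ hN ε v hv hvK Fθ δ hδ hFθ vθ hv0 hstep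
  have hhh₁ : h ≤ h₁ := hh₀.trans (min_le_left _ _)
  have hhρ : C * h ≤ ρ := by
    rw [mul_comm, ← le_div_iff₀ hC]
    exact hh₀.trans ((min_le_right _ _).trans (min_le_left _ _))
  have hhL : h * tab.bound * L ≤ 1 / 2 := by
    rw [mul_assoc, ← le_div_iff₀ (by positivity)]
    exact hh₀.trans ((min_le_right _ _).trans (min_le_right _ _))
  refine discrete_gronwall_step (e := fun n => ‖v (n * h) - vθ n‖) (by positivity) hh.le
    (by positivity) hN.le (by simp [hv0]) fun n hn => ?_
  have hnT : n * h + h ≤ T := by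
    rw [← hN]
    have : ((n + 1 : ℕ) : ℝ) * h ≤ N * h := by gcongr; exact hn
    push_cast at this
    linarith
  have hn0 : 0 ≤ n * h := by positivity
  have hmem : ∀ t ∈ Icc 0 h, n * h + t ∈ Icc 0 T := fun t ht =>
    ⟨add_nonneg hn0 ht.1, (add_le_add_right ht.2 _).trans hnT⟩
  have hvn : (ε, v (n * h)) ∈ K := by simpa using hvK _ (hmem 0 ⟨le_rfl, hh.le⟩)
  obtain ⟨Y, hY, hYx, herr⟩ := hue h ⟨hh, hhh₁⟩ (ε, v (n * h)) hvn
  have herr' := herr (fun t => v (n * h + t)) (by simp) (hv.shift hn0 hnT)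
    fun t ht => hvK _ (hmem t ht)
  obtain ⟨Yθ, hYθK, hYθ, hvθ⟩ := hstep n hn
  have hcmp := (step_compare tab (y := v (n * h)) (y' := vθ n) (k := fun j => F (h, ε, Y j))
    (k' := fun j => Fθ (Yθ j)) hh.le hL.le hδ hhL hY hYθ fun j => by
      have h1 : (h, ε, Y j) ∈ Icc 0 h₁ ×ˢ Metric.cthickening ρ K := by
        refine ⟨⟨hh.le, hhh₁⟩, Metric.mem_cthickening_of_dist_le _ (ε, v (n * h)) _ _ hvn ?_⟩
        rw [Prod.dist_eq, dist_self, dist_eq_norm]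
        exact max_le hρ.le ((hYx j).trans hhρ)
      have h2 := hlip _ h1 (h, ε, Yθ j) ⟨⟨hh.le, hhh₁⟩,
        Metric.self_subset_cthickening K (hYθK j)⟩
      have h3 : ‖(h, ε, Y j) - (h, ε, Yθ j)‖ = ‖Y j - Yθ j‖ := by simp [Prod.norm_def]
      rw [h3] at h2
      calc _ = ‖(F (h, ε, Y j) - F (h, ε, Yθ j)) + (F (h, ε, Yθ j) - Fθ (Yθ j))‖ := by
            congr 1; abel
        _ ≤ _ := (norm_add_le _ _).trans (add_le_add h2 (hFθ _ (hYθK j)))).2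
  have hcast : ((n + 1 : ℕ) : ℝ) * h = n * h + h := by push_cast; ring
  rw [hcast, hvθ]
  calc _ = ‖(v (n * h + h) - stepValue tab (fun _ y => F (h, ε, y)) 0 h (v (n * h)) Y)
        + (stepValue tab (fun _ y => F (h, ε, y)) 0 h (v (n * h)) Y
          - stepValue tab (fun _ => Fθ) (n * h) h (vθ n) Yθ)‖ := by congr 1; abel
    _ ≤ C * h ^ (m + 1) + ((1 + 2 * tab.bound * L * h) * ‖v (n * h) - vθ n‖
          + h * (2 * tab.bound * δ)) := (norm_add_le _ _).trans (add_le_add herr' hcmp)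
    _ = _ := by ring

end Macro

section Periodic

variable {E : Type} [NormedAddCommGroup E] [NormedSpace ℝ E] {f : ℝ → E → E}
  {R : ℝ → ℝ → E → ℝ → E} {RF : E → ℝ → ℝ → E}

theorem phiNet_periodic (R : ℝ → ℝ → E → ℝ → E) (τ : ℝ) (y : E) (ε : ℝ) :
    phiNet R (τ + 2 * Real.pi) y ε = phiNet R τ y ε := by
  simp [phiNet]

theorem gNet_periodic (hper : ∀ τ y, f (τ + 2 * Real.pi) y = f τ y) (τ : ℝ) (w v : E) (ε : ℝ) :
    gNet f R RF (τ + 2 * Real.pi) w v ε = gNet f R RF τ w v ε := by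
  simp only [gNet, micro, hper, phiNet_periodic]
  rw [← deriv_comp_add_const (fun σ => phiNet R σ v ε) (2 * Real.pi) τ]
  simp only [phiNet_periodic]

theorem exists_mem_period {X : Type} {u : ℝ → X} (hu : ∀ τ, u (τ + 2 * Real.pi) = u τ) (τ : ℝ) :
    ∃ τ' ∈ Icc 0 (2 * Real.pi), u τ = u τ' := by
  obtain ⟨τ', hτ', h⟩ := Function.Periodic.exists_mem_Ico₀ hu (by positivity) τ
  exact ⟨τ', Ico_subset_Icc_self hτ', h⟩

end Periodic

section Micro

variable {E : Type} [NormedAddCommGroup E] [NormedSpace ℝ E] [FiniteDimensional ℝ E]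
  {f : ℝ → E → E} {O : Set (ℝ × E)} {p : ℕ}

theorem exists_phi_lipschitz (hf : ContDiff ℝ ∞ (fun x : ℝ × E => f x.1 x.2))
    (hper : ∀ τ y, f (τ + 2 * Real.pi) y = f τ y) (hO : IsOpen O)
    (h : ∀ j ≤ p, PhiRegular f O j) {K : Set (ℝ × E)} (hK : IsCompact K) (hKO : K ⊆ O) :
    ∃ α > (0 : ℝ), ∀ ε v v', (ε, v) ∈ K → (ε, v') ∈ K → ∀ τ,
      ‖phi f ε p τ v - phi f ε p τ v'‖ ≤ α * ‖v - v'‖ := by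
  obtain ⟨α, hα, hlip⟩ := exists_lipschitz_of_compact (isOpen_univ.prod hO) (h p le_rfl).smooth
    ((isCompact_Icc (a := (0 : ℝ)) (b := 2 * Real.pi)).prod hK) (prod_mono (subset_univ _) hKO)
  refine ⟨α, hα, fun ε v v' hv hv' τ => ?_⟩
  have hφ := phi_periodic hf hper hO p fun k hk => h k hk.le
  obtain ⟨τ', hτ', hu⟩ := exists_mem_period (u := fun τ => phi f ε p τ v - phi f ε p τ v')
    (fun τ => by rw [hφ (ε, v) (hKO hv), hφ (ε, v') (hKO hv')]) τ
  have := hlip (τ', ε, v) ⟨hτ', hv⟩ (τ', ε, v') ⟨hτ', hv'⟩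
  rw [show phi f ε p τ v - phi f ε p τ v' = _ from hu]
  simpa [Prod.norm_def] using this

/-- Lipschitz bounds for the micro field, uniform as `ε → 0`, and its size at `w = 0`. -/
theorem exists_micro_bounds (hf : ContDiff ℝ ∞ (fun x : ℝ × E => f x.1 x.2))
    (hper : ∀ τ y, f (τ + 2 * Real.pi) y = f τ y) (hO : IsOpen O) (hp : 1 ≤ p)
    (h : ∀ j ≤ p, PhiRegular f O j) {K : Set (ℝ × E)} (hK : IsCompact K) (hKO : K ⊆ O) (ρ : ℝ) :
    ∃ L > (0 : ℝ), ∃ C > (0 : ℝ),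
      (∀ ε v v', ε ≠ 0 → (ε, v) ∈ K → (ε, v') ∈ K → ∀ w w', ‖w‖ ≤ ρ → ‖w'‖ ≤ ρ → ∀ τ,
        ‖g f p τ w v ε - g f p τ w' v' ε‖ ≤ L * ‖w - w'‖ + L * ‖v - v'‖) ∧
      ∀ ε v, ε ≠ 0 → (ε, v) ∈ K → ∀ τ, ‖g f p τ 0 v ε‖ ≤ C * |ε| ^ p := by
  have : ProperSpace E := FiniteDimensional.proper ℝ E
  obtain ⟨r, hr, hg⟩ := exists_micro_remainder hf hO hp h
  have hG : ContDiffOn ℝ ∞ (fun q : (ℝ × ℝ × E) × E =>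
      f q.1.1 (phi f q.1.2.1 p q.1.1 q.1.2.2 + q.2) - f q.1.1 (phi f q.1.2.1 p q.1.1 q.1.2.2)
        + q.1.2.1 ^ p • r q.1) ((univ ×ˢ O) ×ˢ univ) := by
    have hφ : ContDiffOn ℝ ∞ (fun q : (ℝ × ℝ × E) × E => phi f q.1.2.1 p q.1.1 q.1.2.2)
        ((univ ×ˢ O) ×ˢ univ) := (h p le_rfl).smooth.comp contDiffOn_fst fun q hq => hq.1
    have hr' : ContDiffOn ℝ ∞ (fun q : (ℝ × ℝ × E) × E => r q.1) ((univ ×ˢ O) ×ˢ univ) :=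
      hr.comp contDiffOn_fst fun q hq => hq.1
    have h1 : ContDiffOn ℝ ∞ (fun q : (ℝ × ℝ × E) × E => q.1.1) ((univ ×ˢ O) ×ˢ univ) := by fun_prop
    exact ((hf.comp_contDiffOn (h1.prodMk (hφ.add contDiffOn_snd))).sub
      (hf.comp_contDiffOn (h1.prodMk hφ))).add (ContDiffOn.smul (by fun_prop) hr')
  have hcpt := ((isCompact_Icc (a := (0 : ℝ)) (b := 2 * Real.pi)).prod hK)
  obtain ⟨L, hL, hlip⟩ := exists_lipschitz_of_compact
    ((isOpen_univ.prod hO).prod isOpen_univ) hG (hcpt.prod (isCompact_closedBall (0 : E) ρ))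
    (prod_mono (prod_mono (subset_univ _) hKO) (subset_univ _))
  obtain ⟨C, hC, hb⟩ := exists_bound_of_compact hr hcpt (prod_mono (subset_univ _) hKO)
  refine ⟨L, hL, C, hC, fun ε v v' hε hv hv' w w' hw hw' τ => ?_, fun ε v hε hv τ => ?_⟩
  · obtain ⟨τ', hτ', hu⟩ := exists_mem_period
      (u := fun τ => g f p τ w v ε - g f p τ w' v' ε)
      (fun τ => by rw [micro_periodic hf hper hO h (hKO hv),
        micro_periodic hf hper hO h (hKO hv')]) τ
    have := hlip ((τ', ε, v), w) ⟨⟨hτ', hv⟩, mem_closedBall_zero_iff.2 hw⟩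
      ((τ', ε, v'), w') ⟨⟨hτ', hv'⟩, mem_closedBall_zero_iff.2 hw'⟩
    rw [show g f p τ w v ε - g f p τ w' v' ε = _ from hu]
    rw [hg (ε, v) (hKO hv) hε τ' w, hg (ε, v') (hKO hv') hε τ' w']
    refine this.trans ?_
    rw [← mul_add]
    refine mul_le_mul_of_nonneg_left ?_ hL.le
    simp only [Prod.norm_def, Prod.fst_sub, Prod.snd_sub, sub_self, norm_zero]
    have h1 := norm_nonneg (w - w')
    have h2 := norm_nonneg (v - v')
    refine max_le (max_le (by positivity) (max_le (by positivity) ?_)) ?_ <;> linarith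
  · obtain ⟨τ', hτ', hu⟩ := exists_mem_period (u := fun τ => g f p τ 0 v ε)
      (fun τ => by rw [micro_periodic hf hper hO h (hKO hv)]) τ
    rw [show g f p τ 0 v ε = _ from hu]
    rw [hg (ε, v) (hKO hv) hε τ' 0, add_zero, sub_self, zero_add, norm_smul, norm_pow,
      Real.norm_eq_abs, mul_comm]
    exact mul_le_mul_of_nonneg_right (hb _ ⟨hτ', hv⟩) (by positivity)

omit [FiniteDimensional ℝ E] in
theorem phi_zero_time (f : ℝ → E → E) (ε : ℝ) (p : ℕ) (y : E) : phi f ε p 0 y = y := by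
  cases p with
  | zero => rfl
  | succ p => simp [phi]

omit [FiniteDimensional ℝ E] in
/-- The micro part of the exact solution solves the micro equation. -/
theorem isSolutionOn_micro (hO : IsOpen O) (h : PhiRegular f O p) {ε T : ℝ} {y v : ℝ → E}
    (hy : IsSolutionOn (fun t => f (t / ε)) 0 T y)
    (hv : IsSolutionOn (fun _ => field f ε p) 0 T v) (hvO : ∀ t ∈ Icc 0 T, (ε, v t) ∈ O) :
    IsSolutionOn (fun t w => g f p (t / ε) w (v t) ε) 0 T
      fun t => y t - phi f ε p (t / ε) (v t) := by
  intro t ht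
  have hq : (t / ε, ε, v t) ∈ (univ : Set ℝ) ×ˢ O := ⟨mem_univ _, hvO t ht⟩
  have hΦ : HasFDerivAt (fun q : ℝ × ℝ × E => phi f q.2.1 p q.1 q.2.2) _ (t / ε, ε, v t) :=
    ((h.smooth.contDiffAt ((isOpen_univ.prod hO).mem_nhds hq)).differentiableAt
      (by simp)).hasFDerivAt
  set A := fderiv ℝ (fun q : ℝ × ℝ × E => phi f q.2.1 p q.1 q.2.2) (t / ε, ε, v t) with hA
  have h1 : HasDerivAt (fun σ => phi f ε p σ (v t)) (A (1, 0)) (t / ε) :=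
    hΦ.comp_hasDerivAt (f := fun σ => (σ, ε, v t)) (t / ε)
      ((hasDerivAt_id _).prodMk (hasDerivAt_const _ _))
  have h2 : HasFDerivAt (phi f ε p (t / ε)) (A.comp ((ContinuousLinearMap.inr ℝ ℝ (ℝ × E)).comp
      (ContinuousLinearMap.inr ℝ ℝ E))) (v t) :=
    hΦ.comp (f := fun y => (t / ε, ε, y)) (v t)
      ((hasFDerivAt_prodMk_right (t / ε) (ε, v t)).comp (v t) (hasFDerivAt_prodMk_right ε (v t)))
  have h3 : HasDerivWithinAt (fun σ => (σ / ε, ε, v σ)) (1 / ε, 0, field f ε p (v t)) (Icc 0 T) t :=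
    ((hasDerivAt_id t).div_const ε).hasDerivWithinAt.prodMk
      ((hasDerivWithinAt_const _ _ ε).prodMk (hv t ht))
  have h4 := (hy t ht).sub (hΦ.comp_hasDerivWithinAt t h3)
  refine h4.congr_deriv ?_
  have h5 : ((1 / ε, 0, field f ε p (v t)) : ℝ × ℝ × E) =
      ε⁻¹ • ((1, 0) : ℝ × ℝ × E) + (0, 0, field f ε p (v t)) := by simp
  simp only [g, micro]
  rw [h1.deriv, h2.fderiv, h5, map_add, map_smul, add_sub_cancel]
  simp only [ContinuousLinearMap.comp_apply, ContinuousLinearMap.inr_apply]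
  abel

omit [FiniteDimensional ℝ E] in
/-- Size of the solution of a differential equation with linear growth. -/
theorem norm_le_of_linear_growth {G : ℝ → E → E} {T L c : ℝ} {w : ℝ → E} (hL : 0 < L) (hc : 0 ≤ c)
    (hw : IsSolutionOn G 0 T w) (h0 : w 0 = 0)
    (hb : ∀ t ∈ Icc 0 T, ‖G t (w t)‖ ≤ L * ‖w t‖ + c) :
    ∀ t ∈ Icc 0 T, ‖w t‖ ≤ Real.exp (L * T) / L * c := by
  intro t ht
  have h1 := norm_le_gronwallBound_of_norm_deriv_right_le (f := w) (f' := fun t => G t (w t))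
    (δ := 0) (K := L) (ε := c) (a := 0) (b := T)
    (fun t ht => (hw t ht).continuousWithinAt)
    (fun t ht => (hw t (Ico_subset_Icc_self ht)).mono_of_mem_nhdsWithin (Icc_mem_nhdsGE_of_mem ht))
    (by simp [h0]) (fun t ht => hb t (Ico_subset_Icc_self ht)) t ht
  rw [gronwallBound_of_K_ne_0 hL.ne'] at h1
  have h2 : Real.exp (L * t) ≤ Real.exp (L * T) :=
    Real.exp_le_exp.2 (mul_le_mul_of_nonneg_left ht.2 hL.le)
  calc ‖w t‖ ≤ 0 * Real.exp (L * (t - 0)) + c / L * (Real.exp (L * (t - 0)) - 1) := h1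
    _ ≤ c / L * Real.exp (L * T) := by
      rw [sub_zero, zero_mul, zero_add]
      exact mul_le_mul_of_nonneg_left (by linarith) (by positivity)
    _ = _ := by ring

end Micro

section Micro

variable {E : Type} [NormedAddCommGroup E] [NormedSpace ℝ E] [FiniteDimensional ℝ E]
  {f : ℝ → E → E} {O : Set (ℝ × E)} {p : ℕ}

/-- The micro field in the scaled variable `W = w / ε ^ p`. -/
theorem exists_scaled_micro (hf : ContDiff ℝ ∞ (fun x : ℝ × E => f x.1 x.2)) (hO : IsOpen O)
    (hp : 1 ≤ p) (h : ∀ j ≤ p, PhiRegular f O j) :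
    ∃ γ : ℝ × ℝ × E × E → E, ContDiffOn ℝ ∞ γ {q | (q.2.1, q.2.2.1) ∈ O} ∧
      ∀ ε v, (ε, v) ∈ O → ε ≠ 0 → ∀ τ W, g f p τ (ε ^ p • W) v ε = ε ^ p • γ (τ, ε, v, W) := by
  have : CompleteSpace E := FiniteDimensional.complete ℝ E
  obtain ⟨r, hr, hg⟩ := exists_micro_remainder hf hO hp h
  obtain ⟨B, hB, hfB⟩ := exists_slope hf
  refine ⟨fun q => B (q.1, phi f q.2.1 p q.1 q.2.2.1, q.2.1 ^ p • q.2.2.2) q.2.2.2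
    + r (q.1, q.2.1, q.2.2.1), ?_, fun ε v hx hε τ W => ?_⟩
  · have hφ : ContDiffOn ℝ ∞ (fun q : ℝ × ℝ × E × E => phi f q.2.1 p q.1 q.2.2.1)
        {q | (q.2.1, q.2.2.1) ∈ O} :=
      (h p le_rfl).smooth.comp (f := fun q : ℝ × ℝ × E × E => (q.1, q.2.1, q.2.2.1)) (by fun_prop)
        fun q hq => ⟨mem_univ _, hq⟩
    have hr' : ContDiffOn ℝ ∞ (fun q : ℝ × ℝ × E × E => r (q.1, q.2.1, q.2.2.1))
        {q | (q.2.1, q.2.2.1) ∈ O} :=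
      hr.comp (f := fun q : ℝ × ℝ × E × E => (q.1, q.2.1, q.2.2.1)) (by fun_prop)
        fun q hq => ⟨mem_univ _, hq⟩
    exact ((hB.comp_contDiffOn (contDiffOn_fst.prodMk (hφ.prodMk (by fun_prop)))).clm_apply
      (by fun_prop)).add hr'
  · rw [hg (ε, v) hx hε, hfB, map_smul, ← smul_add]

/-- Local error of the micro part for steps of size at most a multiple of `ε`. -/
theorem micro_local_error {s : ℕ} (tab : ButcherTableau s) (horder : HasOrder tab p)
    (hf : ContDiff ℝ ∞ (fun x : ℝ × E => f x.1 x.2))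
    (hper : ∀ τ y, f (τ + 2 * Real.pi) y = f τ y) (hO : IsOpen O) (hp : 1 ≤ p)
    (h : ∀ j ≤ p, PhiRegular f O j) {Ω : Set E} (hΩ : IsCompact Ω) {εmax ρ : ℝ} (hρ : 0 < ρ)
    (hΩO : ∀ ε ∈ Icc 0 εmax, ∀ v ∈ Ω, ∀ v', ‖v' - v‖ ≤ ρ → (ε, v') ∈ O)
    {Cw Cg : ℝ} (hCg : 0 < Cg) :
    ∃ C > (0 : ℝ), ∃ η > (0 : ℝ), ∀ (h ε t₀ : ℝ) (v w : ℝ → E), 0 < h → 0 < ε → ε ≤ 1 →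
      ε ≤ εmax → h / ε ≤ η → IsSolutionOn (fun _ => field f ε p) 0 h v →
      IsSolutionOn (fun t w => g f p ((t₀ + t) / ε) w (v t) ε) 0 h w →
      (∀ t ∈ Icc 0 h, v t ∈ Ω) → ‖w 0‖ ≤ Cw * ε ^ p →
      (∀ t ∈ Icc 0 h, ‖g f p ((t₀ + t) / ε) (w t) (v t) ε‖ ≤ Cg * ε ^ p) →
      ∃ V W : Fin s → E, (∀ i, V i = v 0 + h • ∑ j, tab.A i j • field f ε p (V j)) ∧
        (∀ i, W i = w 0 + h • ∑ j, tab.A i j • g f p ((t₀ + tab.c j * h) / ε) (W j) (V j) ε) ∧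
        (∀ i, ‖V i - v 0‖ ≤ ρ) ∧ (∀ i, ‖W i - w 0‖ ≤ 1) ∧
        ‖w h - (w 0 + h • ∑ j, tab.b j • g f p ((t₀ + tab.c j * h) / ε) (W j) (V j) ε)‖
          ≤ C * h ^ (p + 1) := by
  have : ProperSpace E := FiniteDimensional.proper ℝ E
  obtain ⟨γ, hγ, hgγ⟩ := exists_scaled_micro hf hO hp h
  set H : ℝ → ℝ → ℝ × ℝ × E → E × E → E × E := fun _ σ P Z =>
    (P.2.1 • field f P.2.1 p Z.1, γ (P.1 + σ, P.2.1, Z.1, P.2.2 + P.2.1 • Z.2)) with hH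
  set D : Set (ℝ × ℝ × (ℝ × ℝ × E) × E × E) := {q | (q.2.2.1.2.1, q.2.2.2.1) ∈ O} with hD
  have hDo : IsOpen D := hO.preimage (by fun_prop)
  have hHs : ContDiffOn ℝ ∞ (fun q : ℝ × ℝ × (ℝ × ℝ × E) × E × E =>
      H q.1 q.2.1 q.2.2.1 q.2.2.2) D := by
    have h1 : ContDiffOn ℝ ∞ (fun q : ℝ × ℝ × (ℝ × ℝ × E) × E × E =>
        field f q.2.2.1.2.1 p q.2.2.2.1) D :=
      ((h p le_rfl).contDiffOn_field hf hO).comp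
        (f := fun q : ℝ × ℝ × (ℝ × ℝ × E) × E × E => (q.2.2.1.2.1, q.2.2.2.1)) (by fun_prop)
        fun q hq => hq
    refine (ContDiffOn.smul (by fun_prop) h1).prodMk ?_
    exact hγ.comp (f := fun q : ℝ × ℝ × (ℝ × ℝ × E) × E × E =>
      (q.2.2.1.1 + q.2.1, q.2.2.1.2.1, q.2.2.2.1, q.2.2.1.2.2 + q.2.2.1.2.1 • q.2.2.2.2))
      (by fun_prop) fun q hq => hq
  set K : Set ((ℝ × ℝ × E) × E × E) := (Icc 0 (2 * Real.pi) ×ˢ Icc 0 εmax ×ˢ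
    Metric.closedBall (0 : E) Cw) ×ˢ (Ω ×ˢ Metric.closedBall (0 : E) 1) with hK
  have hKc : IsCompact K := (isCompact_Icc.prod (isCompact_Icc.prod (isCompact_closedBall _ _))).prod
    (hΩ.prod (isCompact_closedBall _ _))
  have hKO : ∀ x ∈ K, ((0 : ℝ), (0 : ℝ), x) ∈ D := fun x hx =>
    hΩO _ hx.1.2.1 _ hx.2.1 _ (by simpa using hρ.le)
  obtain ⟨C, hC, η₁, hη₁, hue⟩ := uniform_local_error tab hDo hHs hKc hKO (p + 1)
    fun x hx r z hr hz0 hz => by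
      refine horder (E × E) (fun σ Z => H 0 σ x.1 Z) {q | (x.1.2.1, q.2.1) ∈ O}
        (hO.preimage (by fun_prop))
        (hHs.comp (f := fun q : ℝ × E × E => ((0 : ℝ), q.1, x.1, q.2)) (by fun_prop)
          fun q hq => hq) 0 r z hr ?_ (by simpa using hz)
      show (x.1.2.1, (z 0).1) ∈ O
      rw [hz0]
      exact hKO x hx
  refine ⟨C, hC, min η₁ (min (ρ / C) (min (1 / C) (1 / Cg))), by positivity, ?_⟩
  intro h ε t₀ v w hh hε hε1 hεmax hη hv hw hvΩ hw0 hgb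
  have hε0 : ε ≠ 0 := hε.ne'
  set η := h / ε with hηd
  have hηp : 0 < η := div_pos hh hε
  have hεη : ε * η = h := by rw [hηd]; field_simp
  have hηη₁ : η ≤ η₁ := hη.trans (min_le_left _ _)
  have hηρ : C * η ≤ ρ := by
    rw [mul_comm, ← le_div_iff₀ hC]
    exact hη.trans ((min_le_right _ _).trans (min_le_left _ _))
  have hηC : C * η ≤ 1 := by
    rw [mul_comm, ← le_div_iff₀ hC]
    exact hη.trans ((min_le_right _ _).trans ((min_le_right _ _).trans (min_le_left _ _)))
  have hηg : Cg * η ≤ 1 := by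
    rw [mul_comm, ← le_div_iff₀ hCg]
    exact hη.trans ((min_le_right _ _).trans ((min_le_right _ _).trans (min_le_right _ _)))
  obtain ⟨k, hk, -⟩ := existsUnique_sub_zsmul_mem_Ico (by positivity : 0 < 2 * Real.pi) (t₀ / ε) 0
  set τ₀ := t₀ / ε - k • (2 * Real.pi) with hτ₀
  have hεp : 0 < ε ^ p := pow_pos hε p
  have hεp1 : 0 < ε ^ (p + 1) := pow_pos hε _
  set W₀ := (ε ^ p)⁻¹ • w 0 with hW₀
  have hW₀w : ε ^ p • W₀ = w 0 := smul_inv_smul₀ hεp.ne' _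
  have hscale : ∀ σ V Q, (ε, V) ∈ O → g f p (t₀ / ε + σ) (w 0 + ε ^ (p + 1) • Q) V ε =
      ε ^ p • γ (τ₀ + σ, ε, V, W₀ + ε • Q) := by
    intro σ V Q hV
    have hpr : Function.Periodic (fun τ => g f p τ (w 0 + ε ^ (p + 1) • Q) V ε) (2 * Real.pi) :=
      fun τ => micro_periodic hf hper hO ‹_› hV τ _
    have h1 := hpr.sub_zsmul_eq k (x := t₀ / ε + σ)
    have h2 : t₀ / ε + σ - k • (2 * Real.pi) = τ₀ + σ := by rw [hτ₀]; abel
    rw [← hgγ ε V hV hε0, smul_add, hW₀w, smul_smul, ← pow_succ, ← h2]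
    exact h1.symm
  have hx : ((τ₀, ε, W₀), v 0, (0 : E)) ∈ K := by
    refine ⟨⟨?_, ⟨hε.le, hεmax⟩, ?_⟩, hvΩ 0 ⟨le_rfl, hh.le⟩, by simp⟩
    · exact Ico_subset_Icc_self (by simpa using hk)
    · rw [mem_closedBall_zero_iff, hW₀, norm_smul, norm_inv, Real.norm_of_nonneg hεp.le,
        inv_mul_le_iff₀ hεp, mul_comm]
      exact hw0
  obtain ⟨Y, hY, hYx, herr⟩ := hue η ⟨hηp, hηη₁⟩ _ hx
  have hVρ : ∀ i, ‖(Y i).1 - v 0‖ ≤ ρ := fun i =>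
    (norm_fst_le (Y i - (v 0, (0 : E)))).trans ((hYx i).trans hηρ)
  have hQ1 : ∀ i, ‖(Y i).2‖ ≤ 1 := fun i => by
    simpa using (norm_snd_le (Y i - (v 0, (0 : E)))).trans ((hYx i).trans hηC)
  have hVO : ∀ i, (ε, (Y i).1) ∈ O := fun i =>
    hΩO ε ⟨hε.le, hεmax⟩ _ (hvΩ 0 ⟨le_rfl, hh.le⟩) _ (hVρ i)
  have hsum : ∀ c : Fin s → ℝ, h • ∑ j, c j • g f p ((t₀ + tab.c j * h) / ε)
      (w 0 + ε ^ (p + 1) • (Y j).2) (Y j).1 ε =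
      ε ^ (p + 1) • η • ∑ j, c j • (H η (0 + tab.c j * η) (τ₀, ε, W₀) (Y j)).2 := by
    intro c
    have h1 : ∀ j, g f p ((t₀ + tab.c j * h) / ε) (w 0 + ε ^ (p + 1) • (Y j).2) (Y j).1 ε =
        ε ^ p • (H η (0 + tab.c j * η) (τ₀, ε, W₀) (Y j)).2 := by
      intro j
      have h2 : (t₀ + tab.c j * h) / ε = t₀ / ε + (0 + tab.c j * η) := by
        rw [hηd]
        ring
      rw [h2]
      exact hscale _ _ _ (hVO j)
    simp only [h1]
    rw [smul_smul, ← hεη, pow_succ, mul_assoc, ← smul_smul (ε ^ p) (ε * η), smul_comm (ε ^ p)]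
    congr 1
    rw [Finset.smul_sum]
    exact Finset.sum_congr rfl fun j _ => smul_comm _ _ _
  set z : ℝ → E × E := fun σ => (v (ε * σ), (ε ^ (p + 1))⁻¹ • (w (ε * σ) - w 0)) with hz
  have hmaps : MapsTo (fun σ => ε * σ) (Icc 0 η) (Icc 0 h) := fun σ hσ =>
    ⟨mul_nonneg hε.le hσ.1, hεη ▸ mul_le_mul_of_nonneg_left hσ.2 hε.le⟩
  have hlin : ∀ σ, HasDerivWithinAt (fun σ : ℝ => ε * σ) ε (Icc 0 η) σ := fun σ => by
    simpa using ((hasDerivAt_id σ).const_mul ε).hasDerivWithinAt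
  have hzsol : IsSolutionOn (fun t => H 0 t (τ₀, ε, W₀)) 0 η z := by
    intro σ hσ
    have h1 := (hv _ (hmaps hσ)).scomp σ (hlin σ) hmaps
    have h2 := (((hw _ (hmaps hσ)).scomp σ (hlin σ) hmaps).sub_const (w 0)).const_smul
      (ε ^ (p + 1))⁻¹
    refine (h1.prodMk h2).congr_deriv (Prod.ext rfl ?_)
    have h3 := hscale σ (v (ε * σ)) ((ε ^ (p + 1))⁻¹ • (w (ε * σ) - w 0))
      (hΩO ε ⟨hε.le, hεmax⟩ _ (hvΩ _ (hmaps hσ)) _ (by simpa using hρ.le))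
    have h4 : t₀ / ε + σ = (t₀ + ε * σ) / ε := by field_simp
    rw [smul_inv_smul₀ hεp1.ne', add_sub_cancel, h4] at h3
    show (ε ^ (p + 1))⁻¹ • ε • g f p ((t₀ + ε * σ) / ε) (w (ε * σ)) (v (ε * σ)) ε = _
    rw [h3, smul_smul ε, ← pow_succ', inv_smul_smul₀ hεp1.ne']
  have hzK : ∀ t ∈ Icc 0 η, ((τ₀, ε, W₀), z t) ∈ K := by
    intro σ hσ
    refine ⟨hx.1, hvΩ _ (hmaps hσ), ?_⟩
    have h1 := norm_image_sub_le_of_norm_deriv_le_segment' hw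
      (fun t ht => hgb t (Ico_subset_Icc_self ht)) _ (hmaps hσ)
    rw [mem_closedBall_zero_iff, norm_smul, norm_inv, Real.norm_of_nonneg hεp1.le,
      inv_mul_le_iff₀ hεp1]
    refine h1.trans ?_
    calc Cg * ε ^ p * (ε * σ - 0) = ε ^ (p + 1) * (Cg * σ) := by ring
      _ ≤ ε ^ (p + 1) * 1 := by
        refine mul_le_mul_of_nonneg_left (le_trans ?_ hηg) hεp1.le
        exact mul_le_mul_of_nonneg_left hσ.2 hCg.le
  have herr' := herr z (by simp [hz]) hzsol hzK
  refine ⟨fun i => (Y i).1, fun i => w 0 + ε ^ (p + 1) • (Y i).2, fun i => ?_, fun i => ?_, hVρ,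
    fun i => ?_, ?_⟩
  · have h1 := congrArg Prod.fst (hY i)
    simp only [hH, Prod.fst_add, Prod.smul_fst, Prod.fst_sum] at h1
    show (Y i).1 = v 0 + h • ∑ j, tab.A i j • field f ε p (Y j).1
    rw [h1, ← hεη, mul_comm, mul_smul, Finset.smul_sum (r := ε)]
    simp only [smul_comm ε]
  · have h1 := congrArg Prod.snd (hY i)
    rw [hsum]
    refine congrArg (fun Q => w 0 + ε ^ (p + 1) • Q) ?_
    simpa [Prod.snd_sum] using h1
  · rw [add_sub_cancel_left, norm_smul, Real.norm_of_nonneg hεp1.le]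
    exact mul_le_one₀ (pow_le_one₀ hε.le hε1) (norm_nonneg _) (hQ1 i)
  · rw [hsum]
    have h1 := (norm_snd_le _).trans herr'
    have h2 : w h - (w 0 + ε ^ (p + 1) • η • ∑ j, tab.b j •
        (H η (0 + tab.c j * η) (τ₀, ε, W₀) (Y j)).2) = ε ^ (p + 1) •
        (z η - stepValue tab (fun t => H η t (τ₀, ε, W₀)) 0 η (v 0, 0) Y).2 := by
      simp only [hz, stepValue, Prod.snd_sub, Prod.snd_add, Prod.smul_snd, Prod.snd_sum, zero_add,
        smul_sub, smul_inv_smul₀ hεp1.ne', hεη]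
      abel
    rw [h2, norm_smul, Real.norm_of_nonneg hεp1.le]
    calc _ ≤ ε ^ (p + 1) * (C * η ^ (p + 1)) := mul_le_mul_of_nonneg_left h1 hεp1.le
      _ = C * (ε * η) ^ (p + 1) := by ring
      _ = _ := by rw [hεη]

end Micro

theorem gronwall_factor_pos {mu T : ℝ} (hmu : 0 < mu) (hT : 0 < T) :
    0 < (Real.exp (mu * T) - 1) / mu :=
  div_pos (sub_pos.2 (Real.one_lt_exp_iff.2 (mul_pos hmu hT))) hmu

section Micro

variable {E : Type} [NormedAddCommGroup E] [NormedSpace ℝ E] [FiniteDimensional ℝ E]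
  {f : ℝ → E → E} {O : Set (ℝ × E)} {p : ℕ}

/-- Global error of the micro part, given a bound `Γ` for the error of the macro part. -/
theorem microscopic_error {s : ℕ} (tab : ButcherTableau s) (horder : HasOrder tab p)
    (hf : ContDiff ℝ ∞ (fun x : ℝ × E => f x.1 x.2))
    (hper : ∀ τ y, f (τ + 2 * Real.pi) y = f τ y) (hO : IsOpen O) (hp : 1 ≤ p)
    (hreg : ∀ j ≤ p, PhiRegular f O j) {Ω : Set E} (hΩ : IsCompact Ω) {εmax : ℝ}
    (hΩO : Icc 0 εmax ×ˢ Ω ⊆ O) {T : ℝ} (hT : 0 < T) :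
    ∃ mu > (0 : ℝ), ∃ M > (0 : ℝ), ∃ β > (0 : ℝ), ∃ h₀ > (0 : ℝ),
      ∀ (N : ℕ) (h ε : ℝ), 0 < h → h ≤ h₀ → N * h = T → 0 < ε → ε ≤ 1 → ε ≤ εmax →
      ∀ y v : ℝ → E, IsSolutionOn (fun t => f (t / ε)) 0 T y →
      IsSolutionOn (fun _ => field f ε p) 0 T v → v 0 = y 0 →
      (∀ t ∈ Icc 0 T, v t ∈ Ω ∧ y t - phi f ε p (t / ε) (v t) ∈ Ω) →
      ∀ (Fθ : E → E) (gθ : ℝ → E → E → E) (δF δg Γ : ℝ), 0 ≤ δF → 0 ≤ δg → 0 ≤ Γ →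
      (∀ y ∈ Ω, ‖field f ε p y - Fθ y‖ ≤ δF) →
      (∀ τ, ∀ w ∈ Ω, ∀ v ∈ Ω, ‖g f p τ w v ε - gθ τ w v‖ ≤ δg) →
      ∀ vθ wθ : ℕ → E, (∀ n ≤ N, ‖v (n * h) - vθ n‖ ≤ Γ) → wθ 0 = 0 →
      (∀ n < N, ∃ V W : Fin s → E, (∀ i, V i ∈ Ω ∧ W i ∈ Ω) ∧
        (∀ i, V i = vθ n + h • ∑ j, tab.A i j • Fθ (V j)) ∧
        (∀ i, W i = wθ n + h • ∑ j, tab.A i j • gθ ((n * h + tab.c j * h) / ε) (W j) (V j)) ∧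
        wθ (n + 1) = wθ n + h • ∑ j, tab.b j • gθ ((n * h + tab.c j * h) / ε) (W j) (V j)) →
      ∀ n ≤ N, ‖y (n * h) - phi f ε p (n * h / ε) (v (n * h)) - wθ n‖ ≤
        (Real.exp (mu * T) - 1) / mu * (M * h ^ p + β * (Γ + h * δF) + 2 * tab.bound * δg) := by
  have : ProperSpace E := FiniteDimensional.proper ℝ E
  have hκ := tab.bound_pos
  have hκ1 := tab.one_le_bound
  set κ := tab.bound with hκd
  set K : Set (ℝ × E) := Icc 0 εmax ×ˢ Ω with hK
  have hKc : IsCompact K := isCompact_Icc.prod hΩ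
  obtain ⟨ρ, hρ, hρO⟩ := hKc.exists_cthickening_subset_open hO hΩO
  have hKρ : IsCompact (Metric.cthickening ρ K) := hKc.cthickening
  have hthick : ∀ ε ∈ Icc 0 εmax, ∀ v ∈ Ω, ∀ v', ‖v' - v‖ ≤ ρ → (ε, v') ∈ Metric.cthickening ρ K := by
    intro ε hε v hv v' hv'
    refine Metric.mem_cthickening_of_dist_le _ (ε, v) _ _ ⟨hε, hv⟩ ?_
    rw [Prod.dist_eq, dist_self, dist_eq_norm]
    exact max_le hρ.le hv'
  obtain ⟨R, hR⟩ := hΩ.isBounded.exists_norm_le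
  obtain ⟨L, hL, C₀, hC₀, hglip, hg0⟩ := exists_micro_bounds hf hper hO hp hreg hKρ hρO (R + 1)
  obtain ⟨LF, hLF, hFlip⟩ := exists_lipschitz_of_compact hO ((hreg p le_rfl).contDiffOn_field hf hO)
    hKρ hρO
  set Cw := Real.exp (L * T) / L * C₀ with hCw
  have hCwp : 0 < Cw := by positivity
  set Cg := L * Cw + C₀ with hCg
  have hCgp : 0 < Cg := by positivity
  obtain ⟨C₁, hC₁, η, hη, hloc⟩ := micro_local_error tab horder hf hper hO hp hreg hΩ hρ
    (fun ε hε v hv v' hv' => hρO (hthick ε hε v hv v' hv')) (Cw := Cw) hCgp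
  set mu := 2 * κ * L with hmu
  have hmup : 0 < mu := by positivity
  set G := (Real.exp (mu * T) - 1) / mu with hG
  have hGp : 0 < G := gronwall_factor_pos hmup hT
  refine ⟨mu, hmup, C₁ + 2 * κ * C₀ / η ^ p + Cw / (η ^ p * G), by positivity, 4 * κ ^ 2 * L,
    by positivity, min (1 / 2 / (κ * L)) (1 / 2 / (κ * LF)), by positivity, ?_⟩
  intro N h ε hh hh₀ hN hε hε1 hεmax y v hy hv hvy hmem Fθ gθ δF δg Γ hδF hδg hΓ hFθ hgθ vθ wθ hvθ hw0
    hstep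
  have hεK : ε ∈ Icc 0 εmax := ⟨hε.le, hεmax⟩
  have hhL : h * κ * L ≤ 1 / 2 := by
    rw [mul_assoc, ← le_div_iff₀ (by positivity)]
    exact hh₀.trans (min_le_left _ _)
  have hhLF : h * κ * LF ≤ 1 / 2 := by
    rw [mul_assoc, ← le_div_iff₀ (by positivity)]
    exact hh₀.trans (min_le_right _ _)
  have hself : ∀ v ∈ Ω, (ε, v) ∈ Metric.cthickening ρ K := fun v hv =>
    Metric.self_subset_cthickening K ⟨hεK, hv⟩
  have hεp : 0 < ε ^ p := pow_pos hε p
  -- the exact micro part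
  set w : ℝ → E := fun t => y t - phi f ε p (t / ε) (v t) with hw
  have hwsol : IsSolutionOn (fun t w => g f p (t / ε) w (v t) ε) 0 T w :=
    isSolutionOn_micro hO (hreg p le_rfl) hy hv
      fun t ht => hΩO ⟨hεK, (hmem t ht).1⟩
  have hww0 : w 0 = 0 := by simp [hw, phi_zero_time, hvy]
  have hggrow : ∀ τ, ∀ w ∈ Ω, ∀ v ∈ Ω, ‖g f p τ w v ε‖ ≤ L * ‖w‖ + C₀ * ε ^ p := by
    intro τ w hw v hv
    have hR0 : 0 ≤ R := (norm_nonneg w).trans (hR w hw)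
    have h1 := hglip ε v v hε.ne' (hself v hv) (hself v hv) w 0
      ((hR w hw).trans (by linarith)) (by rw [norm_zero]; linarith) τ
    have h2 := hg0 ε v hε.ne' (hself v hv) τ
    rw [abs_of_pos hε] at h2
    rw [sub_self, norm_zero, mul_zero, add_zero, sub_zero] at h1
    calc _ = ‖(g f p τ w v ε - g f p τ 0 v ε) + g f p τ 0 v ε‖ := by rw [sub_add_cancel]
      _ ≤ _ := (norm_add_le _ _).trans (add_le_add h1 h2)
  have hwb : ∀ t ∈ Icc 0 T, ‖w t‖ ≤ Cw * ε ^ p := fun t ht => by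
    have := norm_le_of_linear_growth hL (by positivity : 0 ≤ C₀ * ε ^ p) hwsol hww0
      (fun t ht => hggrow _ _ (hmem t ht).2 _ (hmem t ht).1) t ht
    rwa [← mul_assoc] at this
  have hgb : ∀ t ∈ Icc 0 T, ‖g f p (t / ε) (w t) (v t) ε‖ ≤ Cg * ε ^ p := fun t ht => by
    refine (hggrow _ _ (hmem t ht).2 _ (hmem t ht).1).trans ?_
    have := mul_le_mul_of_nonneg_left (hwb t ht) hL.le
    rw [hCg, add_mul, mul_assoc]
    linarith
  have hnT : ∀ n ≤ N, (n : ℝ) * h ∈ Icc 0 T := fun n hn => ⟨by positivity, by rw [← hN]; gcongr⟩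
  show ∀ n ≤ N, ‖w (n * h) - wθ n‖ ≤ _
  rcases le_or_gt (h / ε) η with hη' | hη'
  · have hrec : ∀ n < N, ‖w ((n + 1 : ℕ) * h) - wθ (n + 1)‖ ≤ (1 + mu * h) * ‖w (n * h) - wθ n‖ +
        h * (C₁ * h ^ p + 4 * κ ^ 2 * L * (Γ + h * δF) + 2 * κ * δg) := by
      intro n hn
      have hcast : ((n + 1 : ℕ) : ℝ) * h = n * h + h := by push_cast; ring
      have hn0 : 0 ≤ (n : ℝ) * h := by positivity
      have hn1 : n * h + h ≤ T := hcast ▸ (hnT (n + 1) hn).2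
      have hsub : ∀ t ∈ Icc 0 h, n * h + t ∈ Icc 0 T := fun t ht =>
        ⟨add_nonneg hn0 ht.1, (add_le_add_right ht.2 _).trans hn1⟩
      obtain ⟨V, W, hV, hW, hVρ, hW1, herr⟩ := hloc h ε (n * h) (fun t => v (n * h + t))
        (fun t => w (n * h + t)) hh hε hε1 hεmax hη' (hv.shift hn0 hn1) (hwsol.shift hn0 hn1)
        (fun t ht => (hmem _ (hsub t ht)).1)
        (by simpa using hwb _ (hsub 0 ⟨le_rfl, hh.le⟩)) (fun t ht => hgb _ (hsub t ht))
      simp only [add_zero] at hV hW hVρ hW1 herr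
      obtain ⟨Vθ, Wθ, hmemθ, hVθ, hWθ, hwθ⟩ := hstep n hn
      have hnΩ := hmem _ (hnT n hn.le)
      have hVK : ∀ j, (ε, V j) ∈ Metric.cthickening ρ K := fun j =>
        hthick ε hεK _ hnΩ.1 _ (hVρ j)
      have hWR : ∀ j, ‖W j‖ ≤ R + 1 := fun j => by
        have h1 : ‖w (n * h)‖ ≤ R := hR _ hnΩ.2
        have := norm_le_norm_add_norm_sub' (W j) (w (n * h))
        linarith [hW1 j]
      have hVdiff := (step_compare tab hh.le hLF.le hδF hhLF hV hVθ fun j => by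
        have h1 := hFlip _ (hVK j) _ (hself _ (hmemθ j).1)
        have h2 : ‖(ε, V j) - (ε, Vθ j)‖ = ‖V j - Vθ j‖ := by simp [Prod.norm_def]
        rw [h2] at h1
        calc _ = ‖(field f ε p (V j) - field f ε p (Vθ j))
              + (field f ε p (Vθ j) - Fθ (Vθ j))‖ := by congr 1; abel
          _ ≤ _ := (norm_add_le _ _).trans (add_le_add h1 (hFθ _ (hmemθ j).1))).1
      have hcmp := (step_compare tab hh.le hL.le
        (by positivity : 0 ≤ L * (2 * (Γ + h * κ * δF)) + δg) hhL hW hWθ fun j => by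
        have h1 := hglip ε (V j) (Vθ j) hε.ne' (hVK j) (hself _ (hmemθ j).1) (W j) (Wθ j) (hWR j)
          ((hR _ (hmemθ j).2).trans (by linarith)) ((n * h + tab.c j * h) / ε)
        have h2 := hgθ ((n * h + tab.c j * h) / ε) _ (hmemθ j).2 _ (hmemθ j).1
        have h3 : ‖V j - Vθ j‖ ≤ 2 * (Γ + h * κ * δF) := (hVdiff j).trans (by
          have := hvθ n hn.le
          gcongr)
        have h4 := mul_le_mul_of_nonneg_left h3 hL.le
        calc _ = ‖(g f p ((n * h + tab.c j * h) / ε) (W j) (V j) ε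
                - g f p ((n * h + tab.c j * h) / ε) (Wθ j) (Vθ j) ε)
              + (g f p ((n * h + tab.c j * h) / ε) (Wθ j) (Vθ j) ε
                - gθ ((n * h + tab.c j * h) / ε) (Wθ j) (Vθ j))‖ := by congr 1; abel
          _ ≤ _ := (norm_add_le _ _).trans (add_le_add h1 h2)
          _ ≤ _ := by linarith).2
      rw [hcast, hwθ]
      have hκδ : h * κ * δF ≤ κ * (h * δF) := by linarith
      have hΓκ : Γ ≤ κ * Γ := le_mul_of_one_le_left hΓ hκ1
      have hfin : 2 * κ * (L * (2 * (Γ + h * κ * δF)) + δg) ≤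
          4 * κ ^ 2 * L * (Γ + h * δF) + 2 * κ * δg := by
        have h5 : Γ + h * κ * δF ≤ κ * (Γ + h * δF) := by linarith
        have := mul_le_mul_of_nonneg_left h5 (by positivity : 0 ≤ 4 * κ * L)
        linarith
      have hfin' := mul_le_mul_of_nonneg_left hfin hh.le
      calc _ ≤ _ := norm_sub_le_norm_sub_add_norm_sub _ _ _
        _ ≤ _ := add_le_add herr hcmp
        _ ≤ _ := by
          rw [pow_succ, hmu]
          linarith
    intro n hn
    refine (discrete_gronwall_step (e := fun n => ‖w (n * h) - wθ n‖) hmup hh.le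
      (by positivity) hN.le (by simp [hww0, hw0]) hrec n hn).trans ?_
    refine mul_le_mul_of_nonneg_left ?_ hGp.le
    have h1 : 0 ≤ (2 * κ * C₀ / η ^ p + Cw / (η ^ p * G)) * h ^ p := by positivity
    linarith
  · have hεh : ε ^ p ≤ h ^ p / η ^ p := by
      rw [← div_pow]
      refine pow_le_pow_left₀ hε.le ?_ p
      rw [le_div_iff₀ hη]
      rw [lt_div_iff₀ hε] at hη'
      linarith
    have hrec : ∀ n < N, ‖wθ (n + 1)‖ ≤ (1 + mu * h) * ‖wθ n‖ +
        h * (2 * κ * (C₀ * ε ^ p + δg)) := by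
      intro n hn
      obtain ⟨Vθ, Wθ, hmemθ, hVθ, hWθ, hwθ⟩ := hstep n hn
      have hcmp := (step_compare tab (y' := (0 : E)) (Y' := fun _ => 0) (k' := fun _ => 0) hh.le hL.le
        (by positivity : 0 ≤ C₀ * ε ^ p + δg) hhL hWθ (by simp) fun j => by
        have h1 := hggrow ((n * h + tab.c j * h) / ε) _ (hmemθ j).2 _ (hmemθ j).1
        have h2 := hgθ ((n * h + tab.c j * h) / ε) _ (hmemθ j).2 _ (hmemθ j).1
        rw [sub_zero, sub_zero]
        have h3 := norm_le_norm_add_norm_sub (g f p ((n * h + tab.c j * h) / ε) (Wθ j) (Vθ j) ε)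
          (gθ ((n * h + tab.c j * h) / ε) (Wθ j) (Vθ j))
        linarith).2
      simp only [smul_zero, Finset.sum_const_zero, add_zero, sub_zero] at hcmp
      rw [hwθ, hmu]
      exact hcmp
    intro n hn
    have h1 := discrete_gronwall_step (e := fun n => ‖wθ n‖) hmup hh.le
      (by positivity) hN.le (by simp [hw0]) hrec n hn
    have h2 := (hwb _ (hnT n hn)).trans (mul_le_mul_of_nonneg_left hεh hCwp.le)
    have h3 : Cw * (h ^ p / η ^ p) = G * (Cw / (η ^ p * G) * h ^ p) := by
      field_simp
    have h4 : G * (2 * κ * (C₀ * ε ^ p + δg)) ≤ G * (2 * κ * C₀ / η ^ p * h ^ p + 2 * κ * δg) := by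
      refine mul_le_mul_of_nonneg_left ?_ hGp.le
      have := mul_le_mul_of_nonneg_left hεh (by positivity : 0 ≤ 2 * κ * C₀)
      have h5 : 2 * κ * C₀ * (h ^ p / η ^ p) = 2 * κ * C₀ / η ^ p * h ^ p := by ring
      linarith
    have h5 : 0 ≤ G * (C₁ * h ^ p + 4 * κ ^ 2 * L * (Γ + h * δF)) := by positivity
    calc ‖w (n * h) - wθ n‖ ≤ ‖w (n * h)‖ + ‖wθ n‖ := norm_sub_le _ _
      _ ≤ G * (Cw / (η ^ p * G) * h ^ p) + G * (2 * κ * C₀ / η ^ p * h ^ p + 2 * κ * δg) :=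
        add_le_add (h2.trans_eq h3) (h1.trans h4)
      _ ≤ _ := by linarith

end Micro

section Global

variable {E : Type} [NormedAddCommGroup E] [NormedSpace ℝ E] [FiniteDimensional ℝ E]

/-- Global error of the micro-macro scheme with fields that approximate the exact ones. -/
theorem global_error {f : ℝ → E → E} (hf : ContDiff ℝ ∞ (fun x : ℝ × E => f x.1 x.2))
    (hper : ∀ τ y, f (τ + 2 * Real.pi) y = f τ y) {T : ℝ} (hT : 0 < T) {Ω : Set E}
    (hΩ : IsCompact Ω) {hmax εmax : ℝ} (hhmax : 0 < hmax) {p q : ℕ} (hp : 1 ≤ p) (hq : 1 ≤ q)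
    {s : ℕ} (tab : ButcherTableau s) (horder : HasOrder tab p)
    (hinv : ∀ k ≤ p, ∀ ε ∈ Icc 0 εmax, ∀ y ∈ Ω, (avgJacobian (phi f ε k) y).IsInvertible)
    {a : ℕ → ℝ → E → E}
    (ha : IsModifiedField tab p (fun ε => field f ε p) a (Icc 0 εmax ×ˢ Ω)) :
    ∃ αφ > (0 : ℝ), ∃ lam > (0 : ℝ), ∃ mu > (0 : ℝ), ∃ β > (0 : ℝ), ∃ M > (0 : ℝ),
    ∃ Cbar > (0 : ℝ), ∃ C > (0 : ℝ), ∀ (N : ℕ) (h : ℝ), 0 < h → N * h = T → h ≤ hmax →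
      ∀ ε, 0 < ε → ε ≤ 1 → ε ≤ εmax → ∀ y v : ℝ → E, IsSolutionOn (fun t => f (t / ε)) 0 T y →
      IsSolutionOn (fun _ => field f ε p) 0 T v → v 0 = y 0 →
      (∀ t ∈ Icc 0 T, v t ∈ Ω ∧ y t - phi f ε p (t / ε) (v t) ∈ Ω) →
      ∀ (φθ : ℝ → E → E) (Fθ : E → E) (gθ : ℝ → E → E → E) (δφ δF δg : ℝ),
      0 ≤ δφ → 0 ≤ δF → 0 ≤ δg →
      (∀ τ, ∀ v ∈ Ω, ‖phi f ε p τ v - φθ τ v‖ ≤ δφ) →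
      (∀ y ∈ Ω, ‖truncModified p q (field f ε p) (fun j => a j ε) h y - Fθ y‖ ≤ δF) →
      (∀ τ, ∀ w ∈ Ω, ∀ v ∈ Ω, ‖g f p τ w v ε - gθ τ w v‖ ≤ δg) →
      ∀ vθ wθ : ℕ → E, vθ 0 = y 0 → wθ 0 = 0 → (∀ n ≤ N, vθ n ∈ Ω ∧ wθ n ∈ Ω) →
      (∀ n < N, ∃ V W : Fin s → E, (∀ i, V i ∈ Ω ∧ W i ∈ Ω) ∧
        (∀ i, V i = vθ n + h • ∑ j, tab.A i j • Fθ (V j)) ∧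
        (∀ i, W i = wθ n + h • ∑ j, tab.A i j • gθ ((n * h + tab.c j * h) / ε) (W j) (V j)) ∧
        vθ (n + 1) = vθ n + h • ∑ j, tab.b j • Fθ (V j) ∧
        wθ (n + 1) = wθ n + h • ∑ j, tab.b j • gθ ((n * h + tab.c j * h) / ε) (W j) (V j)) →
      ∀ n ≤ N, ‖y (n * h) - (φθ (n * h / ε) (vθ n) + wθ n)‖ ≤
        δφ + αφ * ((Real.exp (lam * T) - 1) / lam) * (Cbar * h ^ (p + q - 1) + C * δF)
        + (Real.exp (mu * T) - 1) / mu * (M * h ^ p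
          + (Real.exp (lam * T) - 1) / lam * β * (Cbar * h ^ (p + q - 1) + C * δF) + C * δg) := by
  have hκ := tab.bound_pos
  obtain ⟨U, hU, hKU, has, hloc⟩ := ha
  obtain ⟨O, hO, hKO, hreg⟩ := exists_phiRegular hf (K := Icc 0 εmax ×ˢ Ω) p
    fun k hk x hx => hinv k hk x.1 hx.1 x.2 hx.2
  have hKc : IsCompact (Icc 0 εmax ×ˢ Ω) := isCompact_Icc.prod hΩ
  set S : ℝ × ℝ × E → E := fun r => ∑ j ∈ Finset.range (q - 1), r.1 ^ j • a j r.2.1 r.2.2 with hS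
  have hSs : ContDiffOn ℝ ∞ S (univ ×ˢ U) := by
    refine ContDiffOn.sum fun j _ => ContDiffOn.smul (by fun_prop) ?_
    exact (has j).comp contDiffOn_snd fun r hr => hr.2
  have htr : ∀ h ε y, truncModified p q (field f ε p) (fun j => a j ε) h y =
      field f ε p y + h ^ p • S (h, ε, y) := by
    intro h ε y
    simp only [truncModified, hS, Finset.smul_sum, smul_smul, pow_add]
  have htr0 : ∀ ε y, truncModified p q (field f ε p) (fun j => a j ε) 0 y = field f ε p y := by
    intro ε y
    rw [htr, zero_pow (by omega), zero_smul, add_zero]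
  obtain ⟨CF, hCF, hSb⟩ := exists_bound_of_compact hSs
    ((isCompact_Icc (a := 0) (b := hmax)).prod hKc) (prod_mono (subset_univ _) hKU)
  obtain ⟨m, hm⟩ : ∃ m, p + q = m + 1 := ⟨p + q - 1, by omega⟩
  have hm' : p + q - 1 = m := by omega
  obtain ⟨lam, hlam, Cbar, hCbar, h₁, hh₁, hmac⟩ := macroscopic_error tab (hO.inter hU) hKc
    (subset_inter hKO hKU)
    (F := fun r => truncModified p q (field f r.2.1 p) (fun j => a j r.2.1) r.1 r.2.2) (by
      simp only [htr]
      refine ContDiffOn.add ?_ (ContDiffOn.smul (by fun_prop) ?_)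
      · exact ((hreg p le_rfl).contDiffOn_field hf hO).comp contDiffOn_snd fun r hr => hr.2.1
      · exact hSs.mono (prod_mono_right inter_subset_right)) m
    (fun x hx r z hr hz0 hz => by
      have := hloc x.1 r z hr (by rw [hz0]; exact hKU hx) (by simpa only [htr0] using hz) q hq
      rwa [hm] at this) T
  obtain ⟨mu, hmu, M, hM, β, hβ, h₂, hh₂, hmicro⟩ := microscopic_error tab horder hf hper hO hp hreg hΩ
    hKO hT
  obtain ⟨αφ, hαφ, hφlip⟩ := exists_phi_lipschitz hf hper hO hreg hKc hKO
  obtain ⟨R, hR⟩ := hΩ.isBounded.exists_norm_le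
  set κ := tab.bound with hκd
  set Gl := (Real.exp (lam * T) - 1) / lam with hGl
  set Gm := (Real.exp (mu * T) - 1) / mu with hGm
  have hGlp : 0 < Gl := gronwall_factor_pos hlam hT
  have hGmp : 0 < Gm := gronwall_factor_pos hmu hT
  set h₀ := min h₁ h₂ with hh₀
  have hh₀p : 0 < h₀ := lt_min hh₁ hh₂
  set B := (αφ + 1) * (2 * |R|) with hB
  have hBp : 0 ≤ B := by positivity
  refine ⟨αφ, hαφ, lam, hlam, mu, hmu, β + β * hmax / (Gl * (2 * κ)), by positivity,
    M + β * hmax * CF + B / (h₀ ^ p * Gm), by positivity, Cbar, hCbar, 2 * κ, by positivity, ?_⟩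
  intro N h hh hN hhh ε hε hε1 hεmax y v hy hv hvy hmem φθ Fθ gθ δφ δF δg hδφ hδF hδg hφθ hFθ hgθ
    vθ wθ hv0 hw0 hθ hstep n hn
  rw [hm']
  have hεK : ε ∈ Icc 0 εmax := ⟨hε.le, hεmax⟩
  have hnT : (n : ℝ) * h ∈ Icc 0 T := ⟨by positivity, by rw [← hN]; gcongr⟩
  have hnΩ := hmem _ hnT
  have hθn := hθ n hn
  have hsplit : ‖y (n * h) - (φθ (n * h / ε) (vθ n) + wθ n)‖ ≤ δφ + αφ * ‖v (n * h) - vθ n‖ +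
      ‖y (n * h) - phi f ε p (n * h / ε) (v (n * h)) - wθ n‖ := by
    calc _ = ‖(phi f ε p (n * h / ε) (vθ n) - φθ (n * h / ε) (vθ n))
          + (phi f ε p (n * h / ε) (v (n * h)) - phi f ε p (n * h / ε) (vθ n))
          + (y (n * h) - phi f ε p (n * h / ε) (v (n * h)) - wθ n)‖ := by congr 1; abel
      _ ≤ _ := (norm_add_le _ _).trans (add_le_add ((norm_add_le _ _).trans (add_le_add
          (hφθ _ _ hθn.1) (hφlip ε _ _ ⟨hεK, hnΩ.1⟩ ⟨hεK, hθn.1⟩ _))) le_rfl)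
  have hhp : 0 < h ^ p := pow_pos hh p
  have hhm : 0 < h ^ m := pow_pos hh m
  set Γ := Gl * (Cbar * h ^ m + 2 * κ * δF) with hΓ
  have hΓp : 0 ≤ Γ := by positivity
  have hextra : 0 ≤ β * hmax / (Gl * (2 * κ)) * Γ := by positivity
  rcases le_or_gt h h₀ with hle | hgt
  · have hvθ : ∀ n ≤ N, ‖v (n * h) - vθ n‖ ≤ Γ := by
      refine hmac N h hh (hle.trans (min_le_left _ _)) hN ε v (by simpa only [htr0] using hv)
        (fun t ht => ⟨hεK, (hmem t ht).1⟩) Fθ δF hδF (fun y hy => hFθ y hy.2) vθ (hv0.trans hvy.symm)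
        fun n hn => ?_
      obtain ⟨V, W, hVW, hV, -, hvn, -⟩ := hstep n hn
      exact ⟨V, fun i => ⟨hεK, (hVW i).1⟩, hV, hvn⟩
    have hFF : ∀ y ∈ Ω, ‖field f ε p y - Fθ y‖ ≤ h ^ p * CF + δF := by
      intro y hy
      have h1 := hSb (h, ε, y) ⟨⟨hh.le, hhh⟩, hεK, hy⟩
      have h2 : field f ε p y - Fθ y = -(h ^ p • S (h, ε, y)) +
          (truncModified p q (field f ε p) (fun j => a j ε) h y - Fθ y) := by
        rw [htr]
        abel
      rw [h2]
      refine (norm_add_le _ _).trans (add_le_add ?_ (hFθ y hy))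
      rw [norm_neg, norm_smul, Real.norm_of_nonneg hhp.le]
      exact mul_le_mul_of_nonneg_left h1 hhp.le
    have hw := hmicro N h ε hh (hle.trans (min_le_right _ _)) hN hε hε1 hεmax y v hy hv hvy hmem
      Fθ gθ (h ^ p * CF + δF) δg Γ (by positivity) hδg hΓp hFF hgθ vθ wθ hvθ hw0 (fun n hn => by
        obtain ⟨V, W, hVW, hV, hW, -, hwn⟩ := hstep n hn
        exact ⟨V, W, hVW, hV, hW, hwn⟩) n hn
    have h1 := mul_le_mul_of_nonneg_left (hvθ n hn) hαφ.le
    have h2 : M * h ^ p + β * (Γ + h * (h ^ p * CF + δF)) + 2 * κ * δg ≤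
        (M + β * hmax * CF + B / (h₀ ^ p * Gm)) * h ^ p
          + Gl * (β + β * hmax / (Gl * (2 * κ))) * (Cbar * h ^ m + 2 * κ * δF) + 2 * κ * δg := by
      have h3 : h * (h ^ p * CF + δF) ≤ hmax * (h ^ p * CF + δF) :=
        mul_le_mul_of_nonneg_right hhh (by positivity)
      have h4 := mul_le_mul_of_nonneg_left h3 hβ.le
      have h5 : β * hmax * δF ≤ β * hmax / (Gl * (2 * κ)) * Γ := by
        have h6 : β * hmax / (Gl * (2 * κ)) * Γ =
            β * hmax * δF + β * hmax / (2 * κ) * (Cbar * h ^ m) := by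
          rw [hΓ]
          field_simp
          ring
        have h7 : 0 ≤ β * hmax / (2 * κ) * (Cbar * h ^ m) := by positivity
        linarith
      have h8 : 0 ≤ B / (h₀ ^ p * Gm) * h ^ p := by positivity
      have h9 : Gl * (β + β * hmax / (Gl * (2 * κ))) * (Cbar * h ^ m + 2 * κ * δF) =
          β * Γ + β * hmax / (Gl * (2 * κ)) * Γ := by
        rw [hΓ]
        ring
      rw [h9]
      linarith
    have h3 := mul_le_mul_of_nonneg_left h2 hGmp.le
    calc _ ≤ _ := hsplit
      _ ≤ δφ + αφ * Γ + _ := add_le_add (add_le_add le_rfl h1) (hw.trans h3)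
      _ = _ := by rw [hΓ, mul_assoc αφ]
  · have hR' : ∀ x ∈ Ω, ‖x‖ ≤ |R| := fun x hx => (hR x hx).trans (le_abs_self R)
    have h1 : ‖v (n * h) - vθ n‖ ≤ 2 * |R| := (norm_sub_le _ _).trans
      (by linarith [hR' _ hnΩ.1, hR' _ hθn.1])
    have h2 : ‖y (n * h) - phi f ε p (n * h / ε) (v (n * h)) - wθ n‖ ≤ 2 * |R| :=
      (norm_sub_le _ _).trans (by linarith [hR' _ hnΩ.2, hR' _ hθn.2])
    have h3 := mul_le_mul_of_nonneg_left h1 hαφ.le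
    have h4 : B ≤ Gm * (B / (h₀ ^ p * Gm) * h ^ p) := by
      have h5 : Gm * (B / (h₀ ^ p * Gm) * h ^ p) = B * (h ^ p / h₀ ^ p) := by field_simp
      rw [h5]
      refine le_mul_of_one_le_right hBp ?_
      rw [one_le_div (pow_pos hh₀p p)]
      exact pow_le_pow_left₀ hh₀p.le hgt.le p
    have h6 : 0 ≤ αφ * Gl * (Cbar * h ^ m + 2 * κ * δF) := by positivity
    have h7 : 0 ≤ Gm * ((M + β * hmax * CF) * h ^ p
        + Gl * (β + β * hmax / (Gl * (2 * κ))) * (Cbar * h ^ m + 2 * κ * δF) + 2 * κ * δg) := by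
      positivity
    have h8 : αφ * (2 * |R|) + 2 * |R| = B := by rw [hB]; ring
    calc _ ≤ _ := hsplit
      _ ≤ δφ + B := by linarith
      _ ≤ _ := by linarith

end Global

section Norms

theorem norm_le_of_supNorm {X F : Type*} [NormedAddCommGroup F] {S : Set X} {u : X → ℝ≥0∞}
    (hfin : supNorm S u ≠ ⊤) {x : X} (hx : x ∈ S) {z : F} (hz : ‖z‖ₑ ≤ u x) :
    ‖z‖ ≤ (supNorm S u).toReal := by
  have h1 : ‖z‖ₑ ≤ supNorm S u := hz.trans (le_iSup₂ (f := fun x (_ : x ∈ S) => u x) x hx)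
  have h2 := ENNReal.toReal_mono hfin h1
  rwa [toReal_enorm] at h2

theorem ofReal_error_bound {x dφ ε A b C dF m M lb dg : ℝ} (hdφ : 0 ≤ dφ) (hε : 0 ≤ ε) (hA : 0 ≤ A)
    (hb : 0 ≤ b) (hC : 0 ≤ C) (hdF : 0 ≤ dF) (hm : 0 ≤ m) (hM : 0 ≤ M) (hlb : 0 ≤ lb) (hdg : 0 ≤ dg)
    (hx : x ≤ dφ * ε + A * (b + C * dF) + m * (M + lb * (b + C * dF) + C * dg)) :
    ENNReal.ofReal x ≤ ENNReal.ofReal dφ * ENNReal.ofReal ε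
      + ENNReal.ofReal A * (ENNReal.ofReal b + ENNReal.ofReal C * ENNReal.ofReal dF)
      + ENNReal.ofReal m * (ENNReal.ofReal M
        + ENNReal.ofReal lb * (ENNReal.ofReal b + ENNReal.ofReal C * ENNReal.ofReal dF)
        + ENNReal.ofReal C * ENNReal.ofReal dg) := by
  refine (ENNReal.ofReal_le_ofReal hx).trans_eq ?_
  rw [ENNReal.ofReal_add (by positivity) (by positivity),
    ENNReal.ofReal_add (by positivity) (by positivity), ENNReal.ofReal_mul hdφ,
    ENNReal.ofReal_mul hA, ENNReal.ofReal_mul hm,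
    ENNReal.ofReal_add (p := M + lb * (b + C * dF)) (by positivity) (by positivity),
    ENNReal.ofReal_add hM (by positivity), ENNReal.ofReal_mul hlb, ENNReal.ofReal_add hb (by positivity),
    ENNReal.ofReal_mul hC, ENNReal.ofReal_mul hC]

end Norms

end MicroMacro

theorem mainTheorem2 (d : ℕ)
    (f : ℝ → EuclideanSpace ℝ (Fin d) → EuclideanSpace ℝ (Fin d))
    (hf : ContDiff ℝ ∞ (fun x : ℝ × EuclideanSpace ℝ (Fin d) => f x.1 x.2))
    (hper : ∀ τ y, f (τ + 2 * Real.pi) y = f τ y)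
    (T : ℝ) (hT : 0 < T)
    (Ω : Set (EuclideanSpace ℝ (Fin d))) (hΩ : IsCompact Ω)
    (hmax εmax : ℝ) (hhmax : 0 < hmax) (hεmax : 0 < εmax)
    (p q : ℕ) (hp : 1 ≤ p) (hq : 1 ≤ q)
    (s : ℕ) (tab : ButcherTableau s) (horder : HasOrder tab p)
    (hinv : ∀ k ≤ p, ∀ ε ∈ Set.Icc 0 εmax, ∀ y ∈ Ω,
      (avgJacobian (phi f ε k) y).IsInvertible)
    (a : ℕ → ℝ → EuclideanSpace ℝ (Fin d) → EuclideanSpace ℝ (Fin d))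
    (ha : IsModifiedField tab p (fun ε => field f ε p) a (Set.Icc 0 εmax ×ˢ Ω)) :
    ∃ αφ > (0 : ℝ), ∃ lam > (0 : ℝ), ∃ mu > (0 : ℝ), ∃ β > (0 : ℝ),
    ∃ M' > (0 : ℝ), ∃ Cbar > (0 : ℝ), ∃ C > (0 : ℝ),
      ∀ (R : ℝ → ℝ → EuclideanSpace ℝ (Fin d) → ℝ → EuclideanSpace ℝ (Fin d))
        (RF : EuclideanSpace ℝ (Fin d) → ℝ → ℝ → EuclideanSpace ℝ (Fin d)),
      ContDiff ℝ ∞ (fun x : ℝ × ℝ × EuclideanSpace ℝ (Fin d) × ℝ =>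
        R x.1 x.2.1 x.2.2.1 x.2.2.2) →
      ContDiff ℝ ∞ (fun x : EuclideanSpace ℝ (Fin d) × ℝ × ℝ => RF x.1 x.2.1 x.2.2) →
      ∀ (N : ℕ) (h : ℝ), 0 < N → h = T / N → h ≤ hmax →
      ∀ ε ∈ Set.Ioc (0 : ℝ) 1, ε ≤ εmax →
      ∀ y v : ℝ → EuclideanSpace ℝ (Fin d),
      IsSolutionOn (fun t => f (t / ε)) 0 T y →
      IsSolutionOn (fun _ => field f ε p) 0 T v → v 0 = y 0 →
      (∀ t ∈ Set.Icc 0 T, v t ∈ Ω ∧ y t - phi f ε p (t / ε) (v t) ∈ Ω) →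
      ∀ vθ wθ : ℕ → EuclideanSpace ℝ (Fin d),
      IsScheme tab f R RF Ω h ε N (y 0) vθ wθ →
      ∀ n ≤ N,
        ‖y (n * h) - (phiNet R (n * h / ε) (vθ n) ε + wθ n)‖ₑ ≤
          deltaPhi f p R Ω εmax * ENNReal.ofReal ε
          + ENNReal.ofReal (αφ * ((Real.exp (lam * T) - 1) / lam))
            * (ENNReal.ofReal (Cbar * h ^ (p + q - 1))
              + ENNReal.ofReal C * deltaF f p q a RF Ω hmax εmax)
          + ENNReal.ofReal ((Real.exp (mu * T) - 1) / mu)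
            * (ENNReal.ofReal (M' * h ^ p)
              + ENNReal.ofReal ((Real.exp (lam * T) - 1) / lam * β)
                * (ENNReal.ofReal (Cbar * h ^ (p + q - 1))
                  + ENNReal.ofReal C * deltaF f p q a RF Ω hmax εmax)
              + ENNReal.ofReal C * deltaG f p R RF Ω εmax) := by
  obtain ⟨αφ, hαφ, lam, hlam, mu, hmu, β, hβ, M, hM, Cbar, hCbar, C, hC, hmain⟩ :=
    global_error hf hper hT hΩ hhmax (εmax := εmax) hp hq tab horder hinv ha
  refine ⟨αφ, hαφ, lam, hlam, mu, hmu, β, hβ, M, hM, Cbar, hCbar, C, hC, ?_⟩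
  intro R RF _ _ N h hN hh hhh ε hε hεmax' y v hy hv hvy hmem vθ wθ hscheme n hn
  have hNpos : (0 : ℝ) < N := by exact_mod_cast hN
  have hhpos : 0 < h := by rw [hh]; positivity
  have hNh : N * h = T := by rw [hh]; field_simp
  have hεne : ε ≠ 0 := hε.1.ne'
  have hGl := gronwall_factor_pos hlam hT
  have hGm := gronwall_factor_pos hmu hT
  by_cases hφtop : deltaPhi f p R Ω εmax = ⊤
  · rw [hφtop, ENNReal.top_mul (by simpa using hε.1)]
    simp
  by_cases hFtop : deltaF f p q a RF Ω hmax εmax = ⊤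
  · rw [hFtop, ENNReal.mul_top (by simpa using hC), add_top, ENNReal.mul_top
      (by simpa using mul_pos hαφ hGl)]
    simp
  by_cases hgtop : deltaG f p R RF Ω εmax = ⊤
  · rw [hgtop, ENNReal.mul_top (by simpa using hC), add_top, ENNReal.mul_top (by simpa using hGm)]
    simp
  obtain ⟨O, hO, hKO, hreg⟩ := exists_phiRegular hf (K := Set.Icc 0 εmax ×ˢ Ω) p
    fun k hk x hx => hinv k hk x.1 hx.1 x.2 hx.2
  have hεK : ε ∈ Set.Icc 0 εmax := ⟨hε.1.le, hεmax'⟩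
  have hvO : ∀ v ∈ Ω, (ε, v) ∈ O := fun v hv => hKO ⟨hεK, hv⟩
  have hφb : ∀ τ, ∀ v ∈ Ω, ‖phi f ε p τ v - phiNet R τ v ε‖ ≤
      (deltaPhi f p R Ω εmax).toReal * ε := by
    intro τ v hv
    have hφper := phi_periodic hf hper hO p fun k hk => hreg k hk.le
    obtain ⟨τ', hτ', hu⟩ := exists_mem_period (u := fun τ => phiError f p R ε τ v) (fun τ => by
      simp only [phiError]
      rw [hφper (ε, v) (hvO v hv), phiNet_periodic]) τ
    have h1 : ‖phiError f p R ε τ v‖ ≤ (deltaPhi f p R Ω εmax).toReal := by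
      rw [show phiError f p R ε τ v = phiError f p R ε τ' v from hu]
      exact norm_le_of_supNorm hφtop (x := (ε, τ', v)) ⟨⟨hε.1, hεmax'⟩, hτ', hv⟩ (le_max_left _ _)
    have h2 : phi f ε p τ v - phiNet R τ v ε = ε • phiError f p R ε τ v :=
      (smul_inv_smul₀ hεne _).symm
    rw [h2, norm_smul, Real.norm_of_nonneg hε.1.le, mul_comm]
    exact mul_le_mul_of_nonneg_right h1 hε.1.le
  have hFb : ∀ y ∈ Ω, ‖truncModified p q (field f ε p) (fun j => a j ε) h y - fieldNet f RF y h ε‖ ≤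
      (deltaF f p q a RF Ω hmax εmax).toReal := fun y hy =>
    norm_le_of_supNorm hFtop (x := (y, h, ε)) ⟨hy, ⟨hhpos.le, hhh⟩, hεK⟩ le_rfl
  have hgb : ∀ τ, ∀ w ∈ Ω, ∀ v ∈ Ω, ‖g f p τ w v ε - gNet f R RF τ w v ε‖ ≤
      (deltaG f p R RF Ω εmax).toReal := by
    intro τ w hw v hv
    obtain ⟨τ', hτ', hu⟩ := exists_mem_period
      (u := fun τ => g f p τ w v ε - gNet f R RF τ w v ε) (fun τ => by
        rw [micro_periodic hf hper hO hreg (hvO v hv), gNet_periodic hper]) τ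
    rw [show g f p τ w v ε - gNet f R RF τ w v ε = _ from hu]
    exact norm_le_of_supNorm hgtop (x := (τ', w, v, ε)) ⟨hτ', hw, hv, hε.1, hεmax'⟩ le_rfl
  have key := hmain N h hhpos hNh hhh ε hε.1 hε.2 hεmax' y v hy hv hvy hmem
    (fun τ y => phiNet R τ y ε) (fun y => fieldNet f RF y h ε) (fun τ w v => gNet f R RF τ w v ε)
    ((deltaPhi f p R Ω εmax).toReal * ε) (deltaF f p q a RF Ω hmax εmax).toReal
    (deltaG f p R RF Ω εmax).toReal (by have := hε.1; positivity) ENNReal.toReal_nonneg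
    ENNReal.toReal_nonneg hφb hFb hgb vθ wθ hscheme.init_v hscheme.init_w hscheme.mem
    (fun n hn => by
      obtain ⟨Y, hYΩ, hY, hY1⟩ := hscheme.step n hn
      refine ⟨fun i => (Y i).1, fun i => (Y i).2, hYΩ, fun i => ?_, fun i => ?_, ?_, ?_⟩
      · simpa [Prod.fst_sum, learnedField] using congrArg Prod.fst (hY i)
      · simpa [Prod.snd_sum, learnedField] using congrArg Prod.snd (hY i)
      · simpa [Prod.fst_sum, learnedField, stepValue] using congrArg Prod.fst hY1
      · simpa [Prod.snd_sum, learnedField, stepValue] using congrArg Prod.snd hY1) n hn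
  rw [← ofReal_norm, ← ENNReal.ofReal_toReal hφtop, ← ENNReal.ofReal_toReal hFtop,
    ← ENNReal.ofReal_toReal hgtop]
  exact ofReal_error_bound ENNReal.toReal_nonneg hε.1.le (by positivity) (by positivity) hC.le
    ENNReal.toReal_nonneg hGm.le (by positivity) (by positivity) ENNReal.toReal_nonneg key
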